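/- Let $\mathbb T^2=\mathbb R^2/\mathbb Z^2$, let $\pi:\mathbb R^2\to\mathbb T^2$ be the projection, and let $G$ be a nilpotent subgroup of $\mathrm{Homeo}(\mathbb T^2)$. For $X\in\{\mathbb T^2,\mathbb R^2\}$ let $\mathrm{Homeo}_0(X)$ be the group of homeomorphisms of $X$ isotopic to the identity, and put $G_0=G\cap \mathrm{Homeo}_0(\mathbb T^2)$. A lift of $\phi\in\mathrm{Homeo}(\mathbb T^2)$ is a homeomorphism $\tilde\phi$ of $\mathbb R^2$ with $\pi\circ\tilde\phi=\phi\circ\pi$. Let $\mathcal P(G)$ be the set of $G$-invariant Borel probability measures on $\mathbb T^2$. For $\mu\in\mathcal P(G)$ and a lift $\tilde\phi$ of some $\phi\in G_0$, the map $\tilde\phi-\mathrm{Id}$ is $\mathbb Z^2$-periodic, hence descends to $\mathbb T^2$, and we put $\rho_\mu(\tilde\phi)=\int_{\mathbb T^2}(\tilde\phi-\mathrm{Id})\,d\mu\in\mathbb R^2$. For $\mu\in\mathcal P(G)$ define $$G_{\mathcal I}^{\mu}=\{\phi\in G_0 : \text{there is a lift }\tilde\phi\text{ of }\phi\text{ with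 }\rho_\mu(\tilde\phi)=0\},$$ $$\tilde G_{\mathcal I}^{\mu}=\{\tilde\phi\in\mathrm{Homeo}_0(\mathbb R^2) : \tilde\phi\text{ is a lift of some }\phi\in G_0,\ \rho_\mu(\tilde\phi)=0\},$$ $$\tilde G_{\mathcal I}=\{\tilde\phi\in\mathrm{Homeo}_0(\mathbb R^2) : \tilde\phi\text{ is a lift of some }\phi\in G_0,\ \rho_\nu(\tilde\phi)=0\text{ for all }\nu\in\mathcal P(G)\},$$ and let $G_{\mathcal I}$ be the set of those $\phi\in G_0$ that are $\mathcal P(G)$-irrotational, i.e. $\mathcal P(G)\neq\emptyset$ and $\phi$ has a lift $\tilde\phi$ with $\rho_\nu(\tilde\phi)=0$ for all $\nu\in\mathcal P(G)$. Suppose that there is $\psi\in G$ whose Lefschetz number $L(\psi)=\sum_{k}(-1)^k\,\mathrm{tr}\big(\psi_*|H_k(\mathbb T^2;\mathbb Q)\big)$ is different from $0$. Then $\tilde G_{\mathcal I}=\tilde G_{\mathcal I}^{\mu}$ and $G_{\mathcal I}=G_{\mathcal I}^{\mu}$ for every $\mu\in\mathcal P(G)$. Moreover, $G_{\mathcal I}$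 is a finite-index normal subgroup of $G_0$. -/

import Mathlib

open MeasureTheory CategoryTheory

noncomputable section

namespace TorusAction

/-- The torus `𝕋² = ℝ²/ℤ²`. -/
abbrev Torus : Type := UnitAddTorus (Fin 2)

/-- The plane `ℝ²`, the universal covering space of the torus. -/
abbrev Plane : Type := Fin 2 → ℝ

/-- The universal covering map `π : ℝ² → ℝ²/ℤ²`. -/
def proj (x : Plane) : Torus := fun i => (x i : UnitAddCircle)

/-- `f` is isotopic to the identity: there is a continuous path of homeomorphisms from the
identity to `f`. -/
def IsotopicToId {X : Type*} [TopologicalSpace X] (f : X ≃ₜ X) : Prop :=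
  ∃ H : unitInterval → (X ≃ₜ X),
    Continuous (fun p : unitInterval × X => H p.1 p.2) ∧ H 0 = 1 ∧ H 1 = f

/-- `Homeo₀(X)`: the subgroup of homeomorphisms of `X` isotopic to the identity. -/
def homeo₀ (X : Type*) [TopologicalSpace X] : Subgroup (X ≃ₜ X) where
  carrier := {f | IsotopicToId f}
  one_mem' := ⟨fun _ => 1, continuous_snd, rfl, rfl⟩
  mul_mem' := by
    rintro f g ⟨H, hH, hH0, hH1⟩ ⟨K, hK, hK0, hK1⟩
    refine ⟨fun t => H t * K t, ?_, by simp [hH0, hK0], by simp [hH1, hK1]⟩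
    exact hH.comp (continuous_fst.prodMk hK)
  inv_mem' := by
    rintro f ⟨H, hH, hH0, hH1⟩
    refine ⟨fun t => H (unitInterval.symm t) * f⁻¹, ?_, by simp [hH1], by simp [hH0]⟩
    exact hH.comp ((unitInterval.continuous_symm.comp continuous_fst).prodMk
      (f.continuous_symm.comp continuous_snd))

/-- The trace of the endomorphism induced by a continuous self-map `f` of `X` on the singular
homology `H_k(X; ℚ)`. -/
def homologyTrace {X : Type} [TopologicalSpace X] (k : ℕ) (f : C(X, X)) : ℚ :=
  LinearMap.trace ℚ _
    ((((AlgebraicTopology.singularHomologyFunctor (ModuleCat.{0} ℚ) k).obj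
      (ModuleCat.of ℚ ℚ)).map (TopCat.ofHom f)).hom)

/-- The Lefschetz number `∑ₖ (-1)ᵏ tr (f_* | H_k(𝕋²; ℚ))` of a self-homeomorphism of the torus.
The homology of the torus vanishes in degrees `k > 2`. -/
def lefschetzNumber (f : Torus ≃ₜ Torus) : ℚ :=
  ∑ k ∈ Finset.range 3, (-1) ^ k * homologyTrace k (f : C(Torus, Torus))

/-- `F` is a lift of `f` to the universal covering. -/
def IsLift (F : Plane ≃ₜ Plane) (f : Torus ≃ₜ Torus) : Prop :=
  ∀ x : Plane, proj (F x) = f (proj x)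

/-- The representative in `[0,1)²` of a point of the torus. -/
def rep (p : Torus) : Plane := fun i => (AddCircle.equivIco (1 : ℝ) 0 (p i) : ℝ)

theorem proj_rep (p : Torus) : proj (rep p) = p :=
  funext fun _ => AddCircle.coe_equivIco

/-- The map `F - Id` on the torus. If `F` is a lift of a homeomorphism isotopic to the identity
then `F - Id` is `ℤ²`-periodic, so that the choice of representative is immaterial. -/
def displacement (F : Plane ≃ₜ Plane) (p : Torus) : Plane := F (rep p) - rep p

/-- The rotation vector `ρ_μ(F) = ∫ (F - Id) dμ`. -/
def rotationVector (μ : ProbabilityMeasure Torus) (F : Plane ≃ₜ Plane) : Plane :=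
  ∫ p, displacement F p ∂(μ : Measure Torus)

/-- `𝒫(G)`: the `G`-invariant Borel probability measures. -/
def invariantMeasures (G : Subgroup (Torus ≃ₜ Torus)) : Set (ProbabilityMeasure Torus) :=
  {μ | ∀ f ∈ G, (μ : Measure Torus).map f = μ}

/-- `G₀`: the elements of `G` isotopic to the identity. -/
def identityPart (G : Subgroup (Torus ≃ₜ Torus)) : Subgroup (Torus ≃ₜ Torus) :=
  G ⊓ homeo₀ Torus

/-- `G_I`: the `𝒫(G)`-irrotational elements of `G₀`. -/
def irrotational (G : Subgroup (Torus ≃ₜ Torus)) : Set (Torus ≃ₜ Torus) :=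
  {f | f ∈ identityPart G ∧ (invariantMeasures G).Nonempty ∧
    ∃ F : Plane ≃ₜ Plane, IsLift F f ∧ ∀ μ ∈ invariantMeasures G, rotationVector μ F = 0}

/-- `G_I^μ`. -/
def irrotationalAt (G : Subgroup (Torus ≃ₜ Torus)) (μ : ProbabilityMeasure Torus) :
    Set (Torus ≃ₜ Torus) :=
  {f | f ∈ identityPart G ∧ ∃ F : Plane ≃ₜ Plane, IsLift F f ∧ rotationVector μ F = 0}

/-- The lift of `G_I`: the lifts in `Homeo₀(ℝ²)` of elements of `G₀` whose rotation vector
vanishes for all `G`-invariant measures. -/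
def irrotationalLift (G : Subgroup (Torus ≃ₜ Torus)) : Set (Plane ≃ₜ Plane) :=
  {F | F ∈ homeo₀ Plane ∧ (∃ f ∈ identityPart G, IsLift F f) ∧
    ∀ μ ∈ invariantMeasures G, rotationVector μ F = 0}

/-- The lift of `G_I^μ`: the lifts in `Homeo₀(ℝ²)` of elements of `G₀` whose rotation vector
with respect to `μ` vanishes. -/
def irrotationalLiftAt (G : Subgroup (Torus ≃ₜ Torus)) (μ : ProbabilityMeasure Torus) :
    Set (Plane ≃ₜ Plane) :=
  {F | F ∈ homeo₀ Plane ∧ (∃ f ∈ identityPart G, IsLift F f) ∧ rotationVector μ F = 0}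

end TorusAction

end

/-! A lift `Ψ` of `ψ` satisfies `Ψ (x + n) = Ψ x + A n` for an integer matrix `A`. The Lefschetz
hypothesis enters only through `det (A - 1) ≠ 0`.

If `det (A - 1) = 0`, some primitive integer covector `w` satisfies `w A = w`. In torus coordinates
whose second circle coordinate is `w · x`, the map moves that coordinate by a real-valued function,
so it lifts to the cyclic cover `S¹ × ℝ` commuting with deck transformations. Naturality of the Wang
sequence then makes the traces cancel, so the Lefschetz number is zero (`lefschetz_eq_zero_of_lift`,
`lefschetzNumber_eq_zero`).

For a lift `F` of an element of `G₀`, the commutator `[Ψ, F]` has rotation vector `(A - 1) ρ_μ(F)`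
(`rotationVector_commutator`). By nilpotency, iterating `m` times gives a lift of the identity, that
is, an integer translation. Hence `(A - 1)^m ρ_μ(F)` is an integer vector that does not depend on
`μ` (`exists_pow_mulVec_rotationVector`). Since `A - 1` is invertible over `ℝ`, `ρ_μ(F)` does not
depend on `μ` either, which gives both equalities.

Modulo `ℤ²`, `ρ_μ` is a homomorphism `G₀ → 𝕋²` with kernel `G_I`. Its values are torsion points
killed by `det (A - 1)^m`, so its image is finite and the kernel has finite index. An invariant
measure exists by Markov–Kakutani along the upper central series. -/

noncomputable section

namespace TorusAction

/-! ### Lefschetz numbers on `Y × S¹` through the Wang sequence. -/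

section Homology

open Limits AlgebraicTopology Simplicial

/-- A continuous map from a contractible space lifts through a covering map. -/
theorem exists_lift_of_contractible {A E X : Type*} [TopologicalSpace A] [TopologicalSpace E]
    [TopologicalSpace X] [ContractibleSpace A] {p : E → X} (cov : IsCoveringMap p)
    (surj : Function.Surjective p) (f : C(A, X)) : ∃ F : C(A, E), ∀ a, p (F a) = f a := by
  obtain ⟨a₀, ⟨H⟩⟩ := id_nullhomotopic A
  obtain ⟨e, he⟩ := surj (f a₀)
  -- The contraction is reversed so that time `0` is constant, where a lift is known; time `1` gives
  -- the lift of `f`.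
  let K : C(unitInterval × A, X) := (f.comp H.symm.toContinuousMap)
  have hK : ∀ a, K (0, a) = p (ContinuousMap.const A e a) := by
    intro a
    simp [K, he]
  refine ⟨(cov.liftHomotopy K (ContinuousMap.const A e) hK).comp
    ((ContinuousMap.const A 1).prodMk (ContinuousMap.id A)), fun a => ?_⟩
  have := congrFun (cov.liftHomotopy_lifts K (ContinuousMap.const A e) hK) (1, a)
  exact this.trans (by simp [K])

instance (n : ℕ) : ContractibleSpace (stdSimplex ℝ (Fin (n + 1))) :=
  (convex_stdSimplex ℝ (Fin (n + 1))).contractibleSpace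
    (Set.nonempty_coe_sort.mp inferInstance)

section Finsupp

variable {S B : Type*}

/-- A kernel element is constant on orbits. The action is free, so orbits are infinite, and finite
support forces it to vanish. -/
theorem mapDomain_sub_id_injective (τ : ℤ → S → S) (h0 : ∀ x, τ 0 x = x)
    (hadd : ∀ m n x, τ (m + n) x = τ m (τ n x)) (hfree : ∀ n x, τ n x = x → n = 0) :
    Function.Injective (Finsupp.lmapDomain ℚ ℚ (τ 1) - LinearMap.id :
      (S →₀ ℚ) →ₗ[ℚ] (S →₀ ℚ)) := by
  have hinj : ∀ n, Function.Injective (τ n) := fun n x y h => by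
    have := congrArg (τ (-n)) h
    rwa [← hadd, ← hadd, neg_add_cancel, h0, h0] at this
  refine (injective_iff_map_eq_zero _).2 fun v hv => ?_
  have hv' : Finsupp.mapDomain (τ 1) v = v := by
    simpa [sub_eq_zero] using hv
  have h1 : ∀ x, v (τ 1 x) = v x := fun x => by
    conv_lhs => rw [← hv']
    exact Finsupp.mapDomain_apply (hinj 1) v x
  have hn : ∀ (n : ℕ) x, v (τ n x) = v x := fun n x => by
    induction n with
    | zero => simp [h0]
    | succ n ih => rw [Nat.cast_succ, add_comm, hadd, h1, ih]
  by_contra hne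
  obtain ⟨x, hx⟩ := Finsupp.ne_iff.1 hne
  have hinf : Function.Injective fun n : ℕ => τ n x := fun m n h => by
    have : τ (-(n : ℤ) + m) x = x := by
      rw [hadd]
      simp only at h
      rw [h, ← hadd, neg_add_cancel, h0]
    have := hfree _ _ this
    omega
  refine (Set.infinite_range_of_injective hinf) (v.support.finite_toSet.subset ?_)
  rintro _ ⟨n, rfl⟩
  simpa [hn] using hx

/-- Two basis vectors in one fibre of `q` differ by a telescoping sum in the range of `τ 1 - id`.
So, modulo that range, `v` equals its push-forward by `q` followed by a section. -/
theorem range_mapDomain_sub_id (τ : ℤ → S → S) (h0 : ∀ x, τ 0 x = x)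
    (hadd : ∀ m n x, τ (m + n) x = τ m (τ n x)) (q : S → B) (hsurj : Function.Surjective q)
    (hq : ∀ x y, q x = q y → ∃ n, τ n x = y)
    (v : S →₀ ℚ) (hv : Finsupp.mapDomain q v = 0) :
    ∃ w, (Finsupp.lmapDomain ℚ ℚ (τ 1) - LinearMap.id :
      (S →₀ ℚ) →ₗ[ℚ] (S →₀ ℚ)) w = v := by
  set T : (S →₀ ℚ) →ₗ[ℚ] (S →₀ ℚ) := Finsupp.lmapDomain ℚ ℚ (τ 1) - LinearMap.id
  have hτ : ∀ (n : ℕ) x (r : ℚ), Finsupp.single (τ n x) r - Finsupp.single x r ∈ T.range := by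
    intro n x r
    induction n with
    | zero => simp [h0]
    | succ n ih =>
      have h : Finsupp.single (τ (n + 1 : ℕ) x) r - Finsupp.single (τ n x) r ∈ T.range :=
        ⟨Finsupp.single (τ n x) r, by
          simp [T, Finsupp.mapDomain_single, add_comm (n : ℤ) 1, hadd]⟩
      simpa using add_mem h ih
  have hrel : ∀ x y (r : ℚ), q x = q y →
      Finsupp.single x r - Finsupp.single y r ∈ T.range := by
    intro x y r hxy
    obtain ⟨n, rfl⟩ := hq x y hxy
    obtain ⟨k, rfl | rfl⟩ := n.eq_nat_or_neg
    · simpa using neg_mem (hτ k x r)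
    · have := hτ k (τ (-k) x) r
      rwa [← hadd, add_neg_cancel, h0] at this
  obtain ⟨s, hs⟩ := hsurj.hasRightInverse
  have key : ∀ w : S →₀ ℚ, w - Finsupp.mapDomain s (Finsupp.mapDomain q w) ∈ T.range := by
    intro w
    induction w using Finsupp.induction_linear with
    | zero => simp
    | add f g hf hg =>
      rw [Finsupp.mapDomain_add, Finsupp.mapDomain_add, add_sub_add_comm]
      exact add_mem hf hg
    | single x r =>
      rw [Finsupp.mapDomain_single, Finsupp.mapDomain_single]
      exact hrel _ _ _ (hs _).symm
  have := key v
  rwa [hv, Finsupp.mapDomain_zero, sub_zero] at this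

end Finsupp

/-- Simplicial chains with coefficients in `ℚ`, as finitely supported functions. -/
def chainEquiv (X : SSet.{0}) (n : ℕ) :
    (X.chainComplex (ModuleCat.of ℚ ℚ)).X n ≃ₗ[ℚ] (X _⦋n⦌ →₀ ℚ) :=
  ((X.isColimitChainComplexXCofan (ModuleCat.of ℚ ℚ) n).coconePointUniqueUpToIso
    (ModuleCat.finsuppCoconeIsColimit ℚ ℚ (X _⦋n⦌))).toLinearEquiv

theorem chainEquiv_ι (X : SSet.{0}) (n : ℕ) (x : X _⦋n⦌) (r : ℚ) :
    chainEquiv X n ((X.ιChainComplex (R := ModuleCat.of ℚ ℚ) x).hom r) = Finsupp.single x r := by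
  have := (X.isColimitChainComplexXCofan (ModuleCat.of ℚ ℚ) n).comp_coconePointUniqueUpToIso_hom
    (ModuleCat.finsuppCoconeIsColimit ℚ ℚ (X _⦋n⦌)) ⟨x⟩
  exact congrArg (fun f => f.hom r) this

theorem chainEquiv_map {X Y : SSet.{0}} (f : X ⟶ Y) (n : ℕ)
    (v : (X.chainComplex (ModuleCat.of ℚ ℚ)).X n) :
    chainEquiv Y n (((SSet.chainComplexMap f (ModuleCat.of ℚ ℚ)).f n).hom v) =
      Finsupp.mapDomain (f.app _) (chainEquiv X n v) := by
  obtain ⟨v, rfl⟩ := (chainEquiv X n).symm.surjective v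
  rw [LinearEquiv.apply_symm_apply]
  induction v using Finsupp.induction_linear with
  | zero => simp
  | add f g hf hg => rw [map_add, map_add, map_add, hf, hg, Finsupp.mapDomain_add]
  | single x r =>
    rw [Finsupp.mapDomain_single, ← chainEquiv_ι, LinearEquiv.symm_apply_apply]
    have := SSet.ι_chainComplexMap_f X Y f (ModuleCat.of ℚ ℚ) x
    have := congrArg (fun f => f.hom r) this
    simp only [ModuleCat.hom_comp, LinearMap.comp_apply] at this
    rw [this, chainEquiv_ι]

section Wang

variable (Y : Type) [TopologicalSpace Y]

/-- Translation by `n` in the second factor. -/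
def shiftHom (n : ℤ) : TopCat.of (Y × ℝ) ⟶ TopCat.of (Y × ℝ) :=
  TopCat.ofHom ⟨fun x => (x.1, x.2 + n), by fun_prop⟩

/-- The infinite cyclic covering `Y × ℝ → Y × S¹`. -/
def coverHom : TopCat.of (Y × ℝ) ⟶ TopCat.of (Y × UnitAddCircle) :=
  TopCat.ofHom ⟨fun x => (x.1, (x.2 : UnitAddCircle)),
    continuous_fst.prodMk ((AddCircle.continuous_mk' 1).comp continuous_snd)⟩

/-- The functor of rational singular chains. -/
abbrev chains : TopCat.{0} ⥤ ChainComplex (ModuleCat.{0} ℚ) ℕ :=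
  (singularChainComplexFunctor (ModuleCat.{0} ℚ)).obj (ModuleCat.of ℚ ℚ)

theorem shiftHom_comp_coverHom : shiftHom Y 1 ≫ coverHom Y = coverHom Y := by
  ext x
  · rfl
  · change ((x.2 + ((1 : ℤ) : ℝ) : ℝ) : UnitAddCircle) = (x.2 : UnitAddCircle)
    push_cast
    exact AddCircle.coe_add_period 1 x.2

/-- The sequence `C(Y × ℝ) → C(Y × ℝ) → C(Y × S¹)`. -/
def wangSeq : ShortComplex (ChainComplex (ModuleCat.{0} ℚ) ℕ) :=
  ShortComplex.mk (chains.map (shiftHom Y 1) - 𝟙 _) (chains.map (coverHom Y)) (by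
    rw [Preadditive.sub_comp, ← Functor.map_comp, shiftHom_comp_coverHom, Category.id_comp,
      sub_self])

instance (n : ℕ) : ContractibleSpace (SimplexCategory.toTop.{0}.obj ⦋n⦌) :=
  Homeomorph.ulift.contractibleSpace (Y := stdSimplex ℝ (Fin (n + 1)))

variable {Y} in
theorem coverHom_lift {D : TopCat.{0}} [ContractibleSpace D]
    (σ : D ⟶ TopCat.of (Y × UnitAddCircle)) :
    ∃ σ' : D ⟶ TopCat.of (Y × ℝ), σ' ≫ coverHom Y = σ := by
  obtain ⟨F, hF⟩ := exists_lift_of_contractible (AddCircle.isCoveringMap_coe (1 : ℝ))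
    (QuotientAddGroup.mk_surjective) (ContinuousMap.snd.comp σ.hom)
  refine ⟨TopCat.ofHom ((ContinuousMap.fst.comp σ.hom).prodMk F), ?_⟩
  ext x
  · rfl
  · exact hF x

theorem exists_int_of_continuous {D : Type*} [TopologicalSpace D] [PreconnectedSpace D]
    [Nonempty D] {f : D → ℝ} (hf : Continuous f) (h : ∀ x, ∃ n : ℤ, f x = n) : ∃ n : ℤ, ∀ x, f x = n := by
  choose g hg using h
  have hgc : Continuous g := by
    rw [Int.isClosedEmbedding_coe_real.isEmbedding.continuous_iff]
    exact hf.congr hg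
  obtain ⟨x₀⟩ := ‹Nonempty D›
  exact ⟨g x₀, fun x => by rw [hg, PreconnectedSpace.constant inferInstance hgc (y := x₀)]⟩

theorem exists_int_of_coe_eq {x y : ℝ} (h : (x : UnitAddCircle) = y) : ∃ n : ℤ, y - x = n := by
  obtain ⟨n, hn⟩ := (AddCircle.coe_eq_zero_iff (1 : ℝ) (x := y - x)).1
    (by rw [AddCircle.coe_sub, h, sub_self])
  exact ⟨n, by rw [← hn, zsmul_one]⟩

variable {Y} in
theorem eq_shift_of_coverHom_eq {D : TopCat.{0}} [ContractibleSpace D]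
    (σ τ : D ⟶ TopCat.of (Y × ℝ))
    (h : σ ≫ coverHom Y = τ ≫ coverHom Y) : ∃ n, σ ≫ shiftHom Y n = τ := by
  have h' : ∀ x, coverHom Y (σ x) = coverHom Y (τ x) := fun x => by
    simpa using congrArg (fun f => f x) h
  have : ∃ n : ℤ, ∀ x, (τ x).2 - (σ x).2 = n := by
    apply exists_int_of_continuous
    · exact (continuous_snd.comp τ.hom.continuous).sub (continuous_snd.comp σ.hom.continuous)
    · exact fun x => exists_int_of_coe_eq (congrArg Prod.snd (h' x))
  obtain ⟨n, hn⟩ := this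
  refine ⟨n, TopCat.hom_ext (ContinuousMap.ext fun x => Prod.ext ?_ ?_)⟩
  · have : ((σ x).1, ((σ x).2 : UnitAddCircle)) = ((τ x).1, ((τ x).2 : UnitAddCircle)) := h' x
    exact (Prod.ext_iff.1 this).1
  · change (σ x).2 + (n : ℝ) = (τ x).2
    rw [← hn x]; ring

/-- Simplices are contractible, so those of `Y × S¹` lift to `Y × ℝ`, uniquely up to a shift. In
each degree the simplices upstairs thus form a free `ℤ`-set whose quotient is the set of simplices
downstairs. -/
theorem wangSeq_shortExact : (wangSeq Y).ShortExact := by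
  apply HomologicalComplex.shortExact_of_degreewise_shortExact
  intro n
  let s : ℤ → (TopCat.toSSet.obj (TopCat.of (Y × ℝ))) _⦋n⦌ → _ := fun k =>
    (TopCat.toSSet.map (shiftHom Y k)).app _
  let D := SimplexCategory.toTop.{0}.obj ⦋n⦌
  let E := TopCat.of (Y × ℝ)
  let mkE : (D ⟶ E) → (TopCat.toSSet.obj E) _⦋n⦌ := ULift.up
  have hmkE : Function.Surjective mkE := ULift.up_surjective
  let q : (TopCat.toSSet.obj E) _⦋n⦌ → (TopCat.toSSet.obj (TopCat.of (Y × UnitAddCircle))) _⦋n⦌ :=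
    (TopCat.toSSet.map (coverHom Y)).app _
  have hs : ∀ k x, s k (mkE x) = mkE (x ≫ shiftHom Y k) := fun k x => rfl
  have h0 : ∀ x, s 0 x = x := hmkE.forall.2 fun x => by
    rw [hs]
    refine congrArg mkE (TopCat.hom_ext (ContinuousMap.ext fun y => Prod.ext rfl ?_))
    change (x y).2 + ((0 : ℤ) : ℝ) = (x y).2
    simp
  have hadd : ∀ k m x, s (k + m) x = s k (s m x) := fun k m => hmkE.forall.2 fun x => by
    rw [hs, hs, hs]
    refine congrArg mkE (TopCat.hom_ext (ContinuousMap.ext fun y => Prod.ext rfl ?_))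
    change (x y).2 + ((k + m : ℤ) : ℝ) = (x y).2 + m + k
    push_cast; ring
  have hfree : ∀ k x, s k x = x → k = 0 := fun k => hmkE.forall.2 fun x h => by
    rw [hs] at h
    obtain ⟨y⟩ : Nonempty D := inferInstance
    have := congrArg (fun f : D ⟶ E => (f y).2) (ULift.up_injective h)
    change (x y).2 + (k : ℝ) = (x y).2 at this
    simpa using this
  have hsurj : Function.Surjective q := fun x => by
    obtain ⟨σ, hσ⟩ := coverHom_lift (D := D) x.down
    exact ⟨mkE σ, congrArg ULift.up hσ⟩
  have hq : ∀ x y, q x = q y → ∃ k, s k x = y :=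
    hmkE.forall.2 fun x => hmkE.forall.2 fun y h => by
      obtain ⟨k, hk⟩ := eq_shift_of_coverHom_eq x y (ULift.up_injective h)
      exact ⟨k, congrArg mkE hk⟩
  let eE : ((wangSeq Y).X₂.X n) ≃ₗ[ℚ] _ := chainEquiv (TopCat.toSSet.obj E) n
  let eB : ((wangSeq Y).X₃.X n) ≃ₗ[ℚ] _ :=
    chainEquiv (TopCat.toSSet.obj (TopCat.of (Y × UnitAddCircle))) n
  let F : (wangSeq Y).X₂.X n →ₗ[ℚ] (wangSeq Y).X₂.X n := ((wangSeq Y).f.f n).hom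
  have hf : ∀ v, eE (F v) =
      (Finsupp.lmapDomain ℚ ℚ (s 1) - LinearMap.id : (_ →₀ ℚ) →ₗ[ℚ] (_ →₀ ℚ)) (eE v) := by
    intro v
    let T : (wangSeq Y).X₂.X n →ₗ[ℚ] (wangSeq Y).X₂.X n := ((chains.map (shiftHom Y 1)).f n).hom
    have : F v = T v - v := rfl
    rw [this, map_sub]
    exact congrArg (· - eE v) (chainEquiv_map _ n v)
  have hg : ∀ v, eB (((wangSeq Y).g.f n).hom v) = Finsupp.mapDomain q (eE v) :=
    fun v => chainEquiv_map _ n v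
  have inj : Function.Injective F := fun v w h =>
    eE.injective (mapDomain_sub_id_injective s h0 hadd hfree (by rw [← hf, ← hf, h]))
  have surj : Function.Surjective ((wangSeq Y).g.f n).hom := fun v => by
    obtain ⟨w, hw⟩ := Finsupp.mapDomain_surjective hsurj (eB v)
    exact ⟨eE.symm w, eB.injective (by rw [hg, LinearEquiv.apply_symm_apply, hw])⟩
  have exact : ∀ v, ((wangSeq Y).g.f n).hom v = 0 → ∃ w, F w = v := fun v hv => by
    obtain ⟨w, hw⟩ := range_mapDomain_sub_id s h0 hadd q hsurj hq (eE v)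
      (by rw [← hg, hv, map_zero])
    exact ⟨eE.symm w, eE.injective (by rw [hf, LinearEquiv.apply_symm_apply, hw])⟩
  exact { exact := (ShortComplex.moduleCat_exact_iff _).2 exact
          mono_f := (ModuleCat.mono_iff_injective _).2 inj
          epi_g := (ModuleCat.epi_iff_surjective _).2 surj }

end Wang

/-! ### Additivity of the trace in exact sequences. -/

section Trace

variable {K V₁ V₂ V₃ : Type*} [Field K] [AddCommGroup V₁] [AddCommGroup V₂] [AddCommGroup V₃]
  [Module K V₁] [Module K V₂] [Module K V₃]

/-- This is additivity for `0 → im φ → V₂ → im χ → 0`. Using ranges instead of `V₁` and `V₃` lets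
consecutive terms of a long exact sequence share a summand. -/
theorem trace_eq_add_of_exact [FiniteDimensional K V₂] {φ : V₁ →ₗ[K] V₂} {χ : V₂ →ₗ[K] V₃}
    (hex : Function.Exact φ χ) {f : V₂ →ₗ[K] V₂} {g : V₃ →ₗ[K] V₃} (hχ : ∀ v, χ (f v) = g (χ v))
    (hf : ∀ v ∈ φ.range, f v ∈ φ.range) (hg : ∀ v ∈ χ.range, g v ∈ χ.range) :
    LinearMap.trace K V₂ f =
      LinearMap.trace K φ.range (f.restrict hf) + LinearMap.trace K χ.range (g.restrict hg) := by
  obtain ⟨s, hs⟩ := χ.rangeRestrict.exists_rightInverse_of_surjective χ.range_rangeRestrict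
  have hs' : ∀ w, χ.rangeRestrict (s w) = w := LinearMap.congr_fun hs
  let π : V₂ →ₗ[K] φ.range := (LinearMap.id - s ∘ₗ χ.rangeRestrict).codRestrict _ fun v => by
    obtain ⟨u, hu⟩ := (hex (v - s (χ.rangeRestrict v))).1 (by
      have := congrArg Subtype.val (hs' (χ.rangeRestrict v))
      rw [map_sub, sub_eq_zero]
      exact this.symm)
    exact ⟨u, hu⟩
  -- The section `s` splits the identity of `V₂`; cyclicity of the trace then moves each summand to
  -- its range.
  have hid : f = (f ∘ₗ φ.range.subtype) ∘ₗ π + (f ∘ₗ s) ∘ₗ χ.rangeRestrict := by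
    ext v; simp [π]
  have h1 : π ∘ₗ f ∘ₗ φ.range.subtype = f.restrict hf := by
    ext ⟨_, u, rfl⟩
    have h0 : χ (f (φ u)) = 0 := by rw [hχ, hex.apply_apply_eq_zero, map_zero]
    have h0' : χ.rangeRestrict (f (φ u)) = 0 := Subtype.ext h0
    simp [π, h0']
  have h2 : χ.rangeRestrict ∘ₗ f ∘ₗ s = g.restrict hg := by
    ext w
    have := congrArg Subtype.val (hs' w)
    simp only [LinearMap.comp_apply, LinearMap.coe_restrict_apply]
    rw [← this]
    exact hχ _
  calc LinearMap.trace K V₂ f = LinearMap.trace K V₂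
        ((f ∘ₗ φ.range.subtype) ∘ₗ π + (f ∘ₗ s) ∘ₗ χ.rangeRestrict) := congrArg _ hid
    _ = _ := by rw [map_add, LinearMap.trace_comp_comm', h1, LinearMap.trace_comp_comm', h2]

theorem trace_eq_zero_of_subsingleton [Subsingleton V₁] (f : V₁ →ₗ[K] V₁) :
    LinearMap.trace K V₁ f = 0 := by
  rw [Subsingleton.elim f 0, map_zero]

theorem finiteDimensional_of_exact [FiniteDimensional K V₁] [FiniteDimensional K V₃]
    {φ : V₁ →ₗ[K] V₂} {χ : V₂ →ₗ[K] V₃} (hex : Function.Exact φ χ) : FiniteDimensional K V₂ := by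
  refine ⟨Submodule.fg_of_fg_map_of_fg_inf_ker χ (IsNoetherian.noetherian _) ?_⟩
  rw [top_inf_eq, LinearMap.exact_iff.1 hex]
  exact Module.Finite.iff_fg.1 inferInstance

end Trace

/-- Rational singular homology. -/
abbrev homologyQ (k : ℕ) (X : TopCat.{0}) : ModuleCat.{0} ℚ := (chains.obj X).homology k

/-- Up to homotopy the identity factors through a point, whose homology vanishes in positive degree.
-/
theorem subsingleton_homology_of_contractible (X : TopCat.{0}) [ContractibleSpace X] (k : ℕ)
    (hk : k ≠ 0) : Subsingleton (homologyQ k X) := by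
  obtain ⟨x₀, ⟨h⟩⟩ := id_nullhomotopic X
  let P := TopCat.of PUnit.{1}
  let c : X ⟶ P := TopCat.ofHom (ContinuousMap.const X PUnit.unit)
  let d : P ⟶ X := TopCat.ofHom (ContinuousMap.const PUnit x₀)
  have hh : TopCat.Homotopy (𝟙 X) (c ≫ d) := h
  have h1 := hh.congr_homologyMap_singularChainComplexFunctor (ModuleCat.of ℚ ℚ) k
  have hP : IsZero (homologyQ k P) :=
    isZero_singularHomologyFunctor_of_totallyDisconnectedSpace (ModuleCat ℚ) k (ModuleCat.of ℚ ℚ) P hk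
  rw [Functor.map_comp, HomologicalComplex.homologyMap_comp, hP.eq_zero_of_src
    (HomologicalComplex.homologyMap (chains.map d) k), comp_zero, CategoryTheory.Functor.map_id,
    HomologicalComplex.homologyMap_id] at h1
  exact ModuleCat.subsingleton_of_isZero ((IsZero.iff_id_eq_zero _).2 h1)

theorem finiteDimensional_homology_zero (X : TopCat.{0}) [PathConnectedSpace X] :
    FiniteDimensional ℚ (homologyQ 0 X) := by
  have e := asIso (TopCat.singularHomology₀ε X (ModuleCat.of ℚ ℚ))
  exact e.toLinearEquiv.symm.finiteDimensional

/-- The map induced by a continuous map on homology. -/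
abbrev homologyQMap (k : ℕ) {X Y : TopCat.{0}} (f : X ⟶ Y) : homologyQ k X →ₗ[ℚ] homologyQ k Y :=
  (HomologicalComplex.homologyMap (chains.map f) k).hom

theorem homologyTrace_eq {X : Type} [TopologicalSpace X] (k : ℕ) (f : C(X, X)) :
    homologyTrace k f = LinearMap.trace ℚ _ (homologyQMap k (TopCat.ofHom f)) := rfl

/-- The isomorphism on rational homology induced by a homeomorphism. -/
def homologyQEquiv (k : ℕ) {X Y : TopCat.{0}} (e : X ≅ Y) : homologyQ k X ≃ₗ[ℚ] homologyQ k Y :=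
  ((HomologicalComplex.homologyFunctor _ _ k).mapIso (chains.mapIso e)).toLinearEquiv

theorem homologyTrace_conj {X Y : Type} [TopologicalSpace X] [TopologicalSpace Y] (k : ℕ)
    (e : X ≃ₜ Y) (f : C(X, X)) :
    homologyTrace k ((e : C(X, Y)).comp (f.comp (e.symm : C(Y, X)))) = homologyTrace k f := by
  let i := homologyQEquiv k (TopCat.isoOfHomeo (X := TopCat.of X) (Y := TopCat.of Y) e)
  rw [homologyTrace_eq, homologyTrace_eq, ← LinearMap.trace_conj' _ i]
  congr 1
  ext v
  have : TopCat.ofHom ((e : C(X, Y)).comp (f.comp (e.symm : C(Y, X)))) =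
    TopCat.ofHom (e.symm : C(Y, X)) ≫ TopCat.ofHom f ≫ TopCat.ofHom (e : C(X, Y)) := rfl
  rw [this]
  simp only [homologyQMap, Functor.map_comp, HomologicalComplex.homologyMap_comp]
  rfl

/-! ### The Wang long exact sequence and cancellation of traces. -/

section WangHomology

variable (Y : Type) [TopologicalSpace Y]

/-- The product with the line. -/
abbrev lineProd := TopCat.of (Y × ℝ)
/-- The product with the circle. -/
abbrev circleProd := TopCat.of (Y × UnitAddCircle)

/-- The map `τ_* - 1` on homology. -/
def wangShift (k : ℕ) : homologyQ k (lineProd Y) →ₗ[ℚ] homologyQ k (lineProd Y) :=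
  (HomologicalComplex.homologyMap (wangSeq Y).f k).hom

/-- The connecting homomorphism of the Wang sequence. -/
def wangBoundary (k : ℕ) : homologyQ (k + 1) (circleProd Y) →ₗ[ℚ] homologyQ k (lineProd Y) :=
  ((wangSeq_shortExact Y).δ (k + 1) k rfl).hom

theorem wang_exact₁ (k : ℕ) : Function.Exact (wangBoundary Y k) (wangShift Y k) :=
  (ShortComplex.ShortExact.moduleCat_exact_iff_function_exact _).1
    ((wangSeq_shortExact Y).homology_exact₁ (k + 1) k rfl)

theorem wang_exact₂ (k : ℕ) : Function.Exact (wangShift Y k) (homologyQMap k (coverHom Y)) :=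
  (ShortComplex.ShortExact.moduleCat_exact_iff_function_exact _).1
    ((wangSeq_shortExact Y).homology_exact₂ k)

theorem wang_exact₃ (k : ℕ) : Function.Exact (homologyQMap (k + 1) (coverHom Y)) (wangBoundary Y k) :=
  (ShortComplex.ShortExact.moduleCat_exact_iff_function_exact _).1
    ((wangSeq_shortExact Y).homology_exact₃ (k + 1) k rfl)

theorem wang_surjective : Function.Surjective (homologyQMap 0 (coverHom Y)) := by
  have := (wangSeq_shortExact Y).epi_g
  exact (ModuleCat.epi_iff_surjective _).1
    (HomologicalComplex.epi_homologyMap_of_epi_of_not_rel (wangSeq Y).g 0 (by simp))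

variable {Y}

/-- The endomorphism of the Wang sequence induced by a map commuting with the deck
transformation. -/
def wangEndo {Φ : lineProd Y ⟶ lineProd Y} {φ : circleProd Y ⟶ circleProd Y}
    (h₁ : shiftHom Y 1 ≫ Φ = Φ ≫ shiftHom Y 1)
    (h₂ : coverHom Y ≫ φ = Φ ≫ coverHom Y) : wangSeq Y ⟶ wangSeq Y where
  τ₁ := chains.map Φ
  τ₂ := chains.map Φ
  τ₃ := chains.map φ
  comm₁₂ := by
    change chains.map Φ ≫ (chains.map (shiftHom Y 1) - 𝟙 _) =
      (chains.map (shiftHom Y 1) - 𝟙 _) ≫ chains.map Φ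
    rw [Preadditive.sub_comp, Preadditive.comp_sub, ← Functor.map_comp, ← Functor.map_comp, h₁,
      Category.comp_id, Category.id_comp]
  comm₂₃ := by
    change chains.map Φ ≫ chains.map (coverHom Y) = chains.map (coverHom Y) ≫ chains.map φ
    rw [← Functor.map_comp, ← Functor.map_comp, h₂]

theorem wangShift_comm {Φ : lineProd Y ⟶ lineProd Y} {φ : circleProd Y ⟶ circleProd Y}
    (h₁ : shiftHom Y 1 ≫ Φ = Φ ≫ shiftHom Y 1)
    (h₂ : coverHom Y ≫ φ = Φ ≫ coverHom Y) (k : ℕ) (v : homologyQ k (lineProd Y)) :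
    wangShift Y k (homologyQMap k Φ v) = homologyQMap k Φ (wangShift Y k v) := by
  have := congrArg (fun f : (wangSeq Y).X₁ ⟶ (wangSeq Y).X₂ =>
    (HomologicalComplex.homologyMap f k).hom v) (wangEndo h₁ h₂).comm₁₂
  simp only [HomologicalComplex.homologyMap_comp] at this
  exact this

theorem wangCover_comm {Φ : lineProd Y ⟶ lineProd Y} {φ : circleProd Y ⟶ circleProd Y}
    (h₂ : coverHom Y ≫ φ = Φ ≫ coverHom Y) (k : ℕ) (v : homologyQ k (lineProd Y)) :
    homologyQMap k (coverHom Y) (homologyQMap k Φ v) =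
      homologyQMap k φ (homologyQMap k (coverHom Y) v) := by
  have := congrArg (fun f => homologyQMap k f v) h₂
  simp only [homologyQMap, Functor.map_comp, HomologicalComplex.homologyMap_comp] at this
  exact this.symm

theorem wangBoundary_comm {Φ : lineProd Y ⟶ lineProd Y} {φ : circleProd Y ⟶ circleProd Y}
    (h₁ : shiftHom Y 1 ≫ Φ = Φ ≫ shiftHom Y 1)
    (h₂ : coverHom Y ≫ φ = Φ ≫ coverHom Y) (k : ℕ) (v : homologyQ (k + 1) (circleProd Y)) :
    wangBoundary Y k (homologyQMap (k + 1) φ v) = homologyQMap k Φ (wangBoundary Y k v) := by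
  have := HomologicalComplex.HomologySequence.δ_naturality (wangEndo h₁ h₂)
    (wangSeq_shortExact Y) (wangSeq_shortExact Y) (k + 1) k rfl
  exact (congrArg (fun f => f.hom v) this).symm

theorem range_invariant {K V W : Type*} [Field K] [AddCommGroup V] [AddCommGroup W] [Module K V]
    [Module K W] {χ : V →ₗ[K] W} {f : V → V} {g : W →ₗ[K] W} (h : ∀ v, χ (f v) = g (χ v)) :
    ∀ w ∈ χ.range, g w ∈ χ.range := by
  rintro _ ⟨v, rfl⟩
  exact ⟨f v, h v⟩

/-- The Lefschetz number of a self-map of `Y × S¹` that lifts to a self-map of `Y × ℝ` commuting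
with the deck transformations vanishes. -/
theorem lefschetz_eq_zero_of_lift [FiniteDimensional ℚ (homologyQ 0 (lineProd Y))]
    [FiniteDimensional ℚ (homologyQ 1 (lineProd Y))]
    [Subsingleton (homologyQ 2 (lineProd Y))]
    {Φ : lineProd Y ⟶ lineProd Y} {φ : circleProd Y ⟶ circleProd Y}
    (h₁ : shiftHom Y 1 ≫ Φ = Φ ≫ shiftHom Y 1) (h₂ : coverHom Y ≫ φ = Φ ≫ coverHom Y) :
    LinearMap.trace ℚ _ (homologyQMap 0 φ) - LinearMap.trace ℚ _ (homologyQMap 1 φ) +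
      LinearMap.trace ℚ _ (homologyQMap 2 φ) = 0 := by
  have : FiniteDimensional ℚ (homologyQ 2 (circleProd Y)) := finiteDimensional_of_exact (wang_exact₃ Y 1)
  have : FiniteDimensional ℚ (homologyQ 1 (circleProd Y)) := finiteDimensional_of_exact (wang_exact₃ Y 0)
  -- Surjectivity in degree `0`, phrased as exactness against the zero map so that the trace lemma
  -- also covers the end of the sequence.
  have hz : Function.Exact (homologyQMap 0 (coverHom Y))
      (0 : homologyQ 0 (circleProd Y) →ₗ[ℚ] homologyQ 0 (circleProd Y)) := fun v => by
    simpa using wang_surjective Y v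
  have : FiniteDimensional ℚ (homologyQ 0 (circleProd Y)) :=
    Module.Finite.of_surjective (homologyQMap 0 (coverHom Y)) (wang_surjective Y)
  have f k := range_invariant (wangShift_comm h₁ h₂ k)
  have p k := range_invariant (wangCover_comm h₂ k)
  have d k := range_invariant (wangBoundary_comm h₁ h₂ k)
  -- `e2` and `e3` both compute the trace of `Φ` on `H₁`, so the traces on the images of
  -- `wangBoundary Y 1` and of the covering map in degree `1` agree. `e5` and `e6` do the same one
  -- degree lower. These terms cancel in the alternating sum of `e1`, `e4` and `e7`, leaving the
  -- covering image in degree `2`, which is zero.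
  have e1 := trace_eq_add_of_exact (wang_exact₃ Y 1) (wangBoundary_comm h₁ h₂ 1) (p 2) (d 1)
  have e2 := trace_eq_add_of_exact (wang_exact₁ Y 1) (wangShift_comm h₁ h₂ 1) (d 1) (f 1)
  have e3 := trace_eq_add_of_exact (wang_exact₂ Y 1) (wangCover_comm h₂ 1) (f 1) (p 1)
  have e4 := trace_eq_add_of_exact (wang_exact₃ Y 0) (wangBoundary_comm h₁ h₂ 0) (p 1) (d 0)
  have e5 := trace_eq_add_of_exact (wang_exact₁ Y 0) (wangShift_comm h₁ h₂ 0) (d 0) (f 0)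
  have e6 := trace_eq_add_of_exact (wang_exact₂ Y 0) (wangCover_comm h₂ 0) (f 0) (p 0)
  have e7 := trace_eq_add_of_exact hz (f := homologyQMap 0 φ) (g := 0) (by simp) (p 0)
    (by simp)
  have s1 : Subsingleton (homologyQMap 2 (coverHom Y)).range :=
    (LinearMap.surjective_rangeRestrict (homologyQMap 2 (coverHom Y))).subsingleton
  have s2 : Subsingleton
      (0 : homologyQ 0 (circleProd Y) →ₗ[ℚ] homologyQ 0 (circleProd Y)).range := by
    rw [LinearMap.range_zero]; infer_instance
  have z1 : LinearMap.trace ℚ (homologyQMap 2 (coverHom Y)).range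
      ((homologyQMap 2 φ).restrict (p 2)) = 0 :=
    trace_eq_zero_of_subsingleton _
  have z2 : LinearMap.trace ℚ 
      (0 : homologyQ 0 (circleProd Y) →ₗ[ℚ] homologyQ 0 (circleProd Y)).range
      (LinearMap.restrict (0 : homologyQ 0 (circleProd Y) →ₗ[ℚ] homologyQ 0 (circleProd Y))
        (by simp)) = 0 :=
    trace_eq_zero_of_subsingleton _
  simp only [Nat.reduceAdd] at *
  linarith

end WangHomology

/-- The Wang sequence with `Y = ℝ`, where `Y × ℝ` is contractible, supplies the finiteness and
vanishing needed to use it again with `Y = S¹`. -/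
instance (k : ℕ) : FiniteDimensional ℚ (homologyQ k (circleProd ℝ)) := by
  have (k : ℕ) : FiniteDimensional ℚ (homologyQ k (lineProd ℝ)) := by
    obtain rfl | hk := eq_or_ne k 0
    · exact finiteDimensional_homology_zero _
    · have := subsingleton_homology_of_contractible (lineProd ℝ) k hk
      infer_instance
  cases k with
  | zero => exact Module.Finite.of_surjective (homologyQMap 0 (coverHom ℝ)) (wang_surjective ℝ)
  | succ k => exact finiteDimensional_of_exact (wang_exact₃ ℝ k)

instance : Subsingleton (homologyQ 2 (circleProd ℝ)) := by
  have h1 := subsingleton_homology_of_contractible (lineProd ℝ) 1 one_ne_zero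
  have h2 := subsingleton_homology_of_contractible (lineProd ℝ) 2 two_ne_zero
  refine subsingleton_of_forall_eq 0 fun v => ?_
  obtain ⟨u, rfl⟩ := (wang_exact₃ ℝ 1 v).1 (Subsingleton.elim _ _)
  rw [Subsingleton.elim u 0, map_zero]

/-- The exchange of the two factors. -/
def swapIso : circleProd ℝ ≅ lineProd UnitAddCircle := TopCat.isoOfHomeo (Homeomorph.prodComm _ _)

instance (k : ℕ) : FiniteDimensional ℚ (homologyQ k (lineProd UnitAddCircle)) :=
  (homologyQEquiv k swapIso).finiteDimensional

instance : Subsingleton (homologyQ 2 (lineProd UnitAddCircle)) :=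
  (homologyQEquiv 2 swapIso).symm.injective.subsingleton

/-- Because `h` is real-valued, adding it to the `ℝ` coordinate lifts `φ` to `S¹ × ℝ`, and the lift
commutes with the unit shift. -/
theorem lefschetz_circle_prod (φ : C(UnitAddCircle × UnitAddCircle, UnitAddCircle × UnitAddCircle))
    (h : C(UnitAddCircle × UnitAddCircle, ℝ)) (hh : ∀ x, (φ x).2 = x.2 + (h x : UnitAddCircle)) :
    ∑ k ∈ Finset.range 3, (-1) ^ k * homologyTrace k φ = 0 := by
  let q : C(UnitAddCircle × ℝ, UnitAddCircle × UnitAddCircle) := (coverHom UnitAddCircle).hom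
  let Φ : C(UnitAddCircle × ℝ, UnitAddCircle × ℝ) :=
    (ContinuousMap.fst.comp (φ.comp q)).prodMk (ContinuousMap.snd + h.comp q)
  have hq : ∀ x : UnitAddCircle × ℝ, q (x.1, x.2 + ((1 : ℤ) : ℝ)) = q x := fun x =>
    congrArg (fun f : lineProd UnitAddCircle ⟶ circleProd UnitAddCircle => f x)
      (shiftHom_comp_coverHom UnitAddCircle)
  have := lefschetz_eq_zero_of_lift (Y := UnitAddCircle) (Φ := TopCat.ofHom Φ) (φ := TopCat.ofHom φ)
    (TopCat.hom_ext (ContinuousMap.ext fun x => Prod.ext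
      (congrArg (fun y => (φ y).1) (hq x)) (by
        change x.2 + ((1 : ℤ) : ℝ) + h (q (x.1, x.2 + ((1 : ℤ) : ℝ))) = x.2 + h (q x) + ((1 : ℤ) : ℝ)
        rw [hq]; ring)))
    (TopCat.hom_ext (ContinuousMap.ext fun x => Prod.ext rfl (by
        change (φ (q x)).2 = ((x.2 + h (q x) : ℝ) : UnitAddCircle)
        rw [hh, AddCircle.coe_add]; rfl)))
  simp only [← homologyTrace_eq] at this
  simp [Finset.sum_range_succ]
  linarith

end Homology

/-! ### Lifts of torus homeomorphisms and their action on `ℤ²`. -/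

/-- A vector of integers, as a vector of the plane. -/
def intVec (n : Fin 2 → ℤ) : Plane := fun i => n i

theorem intVec_add (m n : Fin 2 → ℤ) : intVec (m + n) = intVec m + intVec n := by
  ext i; simp [intVec]

theorem intVec_injective : Function.Injective intVec := fun m n h =>
  funext fun i => by simpa [intVec] using congrFun h i

theorem continuous_proj : Continuous proj :=
  continuous_pi fun i => (AddCircle.continuous_mk' 1).comp (continuous_apply i)

theorem isOpenQuotientMap_proj : IsOpenQuotientMap proj :=
  IsOpenQuotientMap.piMap fun _ => QuotientAddGroup.isOpenQuotientMap_mk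

theorem proj_add (x y : Plane) : proj (x + y) = proj x + proj y := rfl

theorem proj_intVec (n : Fin 2 → ℤ) : proj (intVec n) = 0 := by
  ext i
  exact (AddCircle.coe_eq_zero_iff 1).2 ⟨n i, by simp [intVec]⟩

theorem proj_add_intVec (x : Plane) (n : Fin 2 → ℤ) : proj (x + intVec n) = proj x := by
  rw [proj_add, proj_intVec, add_zero]

theorem exists_eq_add_intVec {x y : Plane} (h : proj x = proj y) : ∃ n, y = x + intVec n := by
  choose n hn using fun i => exists_int_of_coe_eq (congrFun h i)
  exact ⟨n, by ext i; simp [intVec, ← hn i]⟩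

/-- `rep` is discontinuous; periodicity makes its choice harmless, so `g ∘ rep` is the descended
map. -/
theorem comp_rep_proj {Z : Type*} {g : Plane → Z} (hper : ∀ x n, g (x + intVec n) = g x) (x : Plane) :
    g (rep (proj x)) = g x := by
  obtain ⟨n, hn⟩ := exists_eq_add_intVec (proj_rep (proj x))
  exact (hper _ n).symm.trans (congrArg g hn.symm)

theorem continuous_comp_rep {Z : Type*} [TopologicalSpace Z] {g : Plane → Z} (hg : Continuous g)
    (hper : ∀ x n, g (x + intVec n) = g x) : Continuous (g ∘ rep) :=
  isOpenQuotientMap_proj.isQuotientMap.continuous_iff.2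
    (hg.congr fun x => (comp_rep_proj hper x).symm)

theorem exists_proj_lift {A : Type*} [TopologicalSpace A] [ContractibleSpace A] (f : C(A, Torus)) :
    ∃ F : C(A, Plane), ∀ a, proj (F a) = f a := by
  choose F hF using fun i : Fin 2 => exists_lift_of_contractible
    (AddCircle.isCoveringMap_coe (1 : ℝ)) QuotientAddGroup.mk_surjective
    ((ContinuousMap.eval i).comp f)
  exact ⟨ContinuousMap.pi F, fun a => funext fun i => hF i a⟩

theorem exists_intVec_of_proj_eq {A : Type*} [TopologicalSpace A] [PreconnectedSpace A] [Nonempty A]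
    {F F' : A → Plane} (hF : Continuous F) (hF' : Continuous F')
    (h : ∀ a, proj (F a) = proj (F' a)) :
    ∃ n, ∀ a, F' a = F a + intVec n := by
  choose n hn using fun i : Fin 2 => exists_int_of_continuous
    (((continuous_apply i).comp hF').sub ((continuous_apply i).comp hF))
    (fun a => exists_int_of_coe_eq (congrFun (h a) i))
  refine ⟨n, fun a => funext fun i => ?_⟩
  have : F' a i - F a i = n i := hn i a
  simp [intVec, ← this]

theorem exists_isLift (f : Torus ≃ₜ Torus) : ∃ F : Plane ≃ₜ Plane, IsLift F f := by
  obtain ⟨F, hF⟩ := exists_proj_lift ((f : C(Torus, Torus)).comp ⟨proj, continuous_proj⟩)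
  obtain ⟨K, hK⟩ := exists_proj_lift ((f.symm : C(Torus, Torus)).comp ⟨proj, continuous_proj⟩)
  replace hF : ∀ x, proj (F x) = f (proj x) := hF
  replace hK : ∀ x, proj (K x) = f.symm (proj x) := hK
  obtain ⟨m, hm⟩ := exists_intVec_of_proj_eq continuous_id (K.continuous.comp F.continuous)
    fun x => by simp [hF, hK]
  obtain ⟨n, hn⟩ := exists_intVec_of_proj_eq continuous_id (F.continuous.comp K.continuous)
    fun x => by simp [hF, hK]
  have h1 : Function.Injective F := fun x y h => by
    have hx := hm x
    have hy := hm y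
    simp only [Function.comp_apply, id, h] at hx hy
    exact add_right_cancel (hx.symm.trans hy)
  have h2 : ∀ y, F (K (y - intVec n)) = y := fun y => by
    have := hn (y - intVec n)
    simpa using this
  -- `F ∘ K` is translation by `n`, so `K` must be corrected by `-n` to be an inverse.
  refine ⟨⟨⟨F, fun y => K (y - intVec n), fun x => h1 (h2 _), h2⟩, F.continuous,
    K.continuous.comp (continuous_id.sub continuous_const)⟩, hF⟩

theorem IsLift.mul {F K : Plane ≃ₜ Plane} {f k : Torus ≃ₜ Torus} (hF : IsLift F f)
    (hK : IsLift K k) : IsLift (F * K) (f * k) := fun x => by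
  change proj (F (K x)) = f (k (proj x))
  rw [hF, hK]

theorem IsLift.inv {F : Plane ≃ₜ Plane} {f : Torus ≃ₜ Torus} (hF : IsLift F f) :
    IsLift F⁻¹ f⁻¹ := fun x => by
  change proj (F.symm x) = f.symm (proj x)
  rw [Homeomorph.eq_symm_apply, ← hF, Homeomorph.apply_symm_apply]

theorem isLift_one : IsLift 1 1 := fun _ => rfl

theorem IsLift.exists_eq_add {F K : Plane ≃ₜ Plane} {f : Torus ≃ₜ Torus} (hF : IsLift F f)
    (hK : IsLift K f) : ∃ n, ∀ x, K x = F x + intVec n :=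
  exists_intVec_of_proj_eq F.continuous K.continuous fun x => by rw [hF, hK]

/-- `F (x + n)` and `F x` lie over the same point, so by connectedness their difference is an
integer vector independent of `x`; it is additive in `n`. -/
theorem IsLift.exists_matrix {F : Plane ≃ₜ Plane} {f : Torus ≃ₜ Torus} (hF : IsLift F f) :
    ∃ A : Matrix (Fin 2) (Fin 2) ℤ, ∀ x n, F (x + intVec n) = F x + intVec (A.mulVec n) := by
  choose a ha using fun n => exists_intVec_of_proj_eq F.continuous
    (F.continuous.comp (continuous_id.add (continuous_const (y := intVec n))))
    fun x => by simp [hF x, hF (x + intVec n), proj_add_intVec]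
  replace ha : ∀ n x, F (x + intVec n) = F x + intVec (a n) := ha
  have hadd : ∀ m n, a (m + n) = a m + a n := fun m n => intVec_injective <| by
    have h1 := ha n (0 + intVec m)
    rw [add_assoc, ← intVec_add, ha, ha, add_assoc] at h1
    rw [add_left_cancel h1, intVec_add]
  let α : (Fin 2 → ℤ) →+ (Fin 2 → ℤ) := AddMonoidHom.mk' a hadd
  refine ⟨LinearMap.toMatrix' α.toIntLinearMap, fun x n => ?_⟩
  rw [LinearMap.toMatrix'_mulVec]
  exact ha n x

/-- The homeomorphisms of the plane commuting with integer translations. -/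
def CommutesWithTranslations (F : Plane ≃ₜ Plane) : Prop :=
  ∀ x n, F (x + intVec n) = F x + intVec n

/-- The whole isotopy lifts to `[0,1] × ℝ²`. The effect of translating by `n` is an integer vector
constant in time, and at time `0` the lift is a translation, so that vector is `n`. -/
theorem IsLift.commutesWithTranslations {F : Plane ≃ₜ Plane} {f : Torus ≃ₜ Torus} (hF : IsLift F f)
    (hf : f ∈ homeo₀ Torus) : CommutesWithTranslations F := by
  obtain ⟨H, hH, hH0, hH1⟩ := hf
  have : ContractibleSpace unitInterval := (convex_Icc (0 : ℝ) 1).contractibleSpace ⟨0, by simp⟩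
  obtain ⟨K, hK⟩ := exists_proj_lift (A := unitInterval × Plane)
    ⟨fun p => H p.1 (proj p.2), hH.comp (continuous_fst.prodMk (continuous_proj.comp continuous_snd))⟩
  replace hK : ∀ t x, proj (K (t, x)) = H t (proj x) := fun t x => hK (t, x)
  intro x n
  obtain ⟨m, hm⟩ := exists_intVec_of_proj_eq (A := unitInterval × Plane) K.continuous
    (K.continuous.comp (continuous_fst.prodMk (continuous_snd.add (continuous_const (y := intVec n)))))
    fun p => by
      obtain ⟨t, x⟩ := p
      simp [hK, proj_add_intVec]
  obtain ⟨c, hc⟩ := exists_intVec_of_proj_eq (A := Plane) continuous_id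
    (K.continuous.comp (continuous_const (y := (0 : unitInterval)) |>.prodMk continuous_id))
    fun x => by simp [hK, hH0]
  obtain ⟨d, hd⟩ := exists_intVec_of_proj_eq (A := Plane)
    (K.continuous.comp (continuous_const (y := (1 : unitInterval)) |>.prodMk continuous_id))
    F.continuous
    fun x => by simp [hK, hH1, hF x]
  replace hm : ∀ t x, K (t, x + intVec n) = K (t, x) + intVec m := fun t x => hm (t, x)
  replace hc : ∀ x, K (0, x) = x + intVec c := hc
  replace hd : ∀ x, F x = K (1, x) + intVec d := hd
  have h0 := hm 0 0
  rw [hc, hc] at h0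
  have hmn : intVec m = intVec n := by
    have : intVec n + intVec c = intVec m + intVec c := by simpa [add_comm] using h0
    exact (add_right_cancel this).symm
  rw [hd, hd, hm, hmn]
  abel

/-! ### From a nonzero Lefschetz number to `det (A - 1) ≠ 0`. -/

/-- The automorphism of the torus given by an integral matrix of determinant `-1`, with values in
`S¹ × S¹`. -/
def integralHomeo (a b u v : ℤ) (h : a * u + b * v = 1) :
    Torus ≃ₜ UnitAddCircle × UnitAddCircle where
  toFun x := (a • x 1 - b • x 0, u • x 0 + v • x 1)
  invFun y := ![a • y.2 - v • y.1, b • y.2 + u • y.1]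
  left_inv x := by
    ext i
    fin_cases i
    · calc a • (u • x 0 + v • x 1) - v • (a • x 1 - b • x 0) = (a * u + b * v) • x 0 := by module
        _ = x 0 := by rw [h, one_smul]
    · calc b • (u • x 0 + v • x 1) + u • (a • x 1 - b • x 0) = (a * u + b * v) • x 1 := by module
        _ = x 1 := by rw [h, one_smul]
  right_inv y := by
    refine Prod.ext ?_ ?_
    · calc a • (b • y.2 + u • y.1) - b • (a • y.2 - v • y.1) = (a * u + b * v) • y.1 := by module
        _ = y.1 := by rw [h, one_smul]
    · calc u • (a • y.2 - v • y.1) + v • (b • y.2 + u • y.1) = (a * u + b * v) • y.2 := by module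
        _ = y.2 := by rw [h, one_smul]
  continuous_toFun := by fun_prop
  continuous_invFun := by
    refine continuous_pi fun i => ?_
    fin_cases i
    · change Continuous fun y : UnitAddCircle × UnitAddCircle => a • y.2 - v • y.1
      fun_prop
    · change Continuous fun y : UnitAddCircle × UnitAddCircle => b • y.2 + u • y.1
      fun_prop

/-- A left null vector of `A - 1` is divided by its gcd; coprimality is what allows `w` to serve as
a circle coordinate. -/
theorem exists_coprime_vecMul_eq {A : Matrix (Fin 2) (Fin 2) ℤ} (h : (A - 1).det = 0) :
    ∃ w : Fin 2 → ℤ, IsCoprime (w 0) (w 1) ∧ Matrix.vecMul w A = w := by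
  obtain ⟨w, hw, hwA⟩ := Matrix.exists_vecMul_eq_zero_iff.2 h
  have hg : 0 < (w 0).gcd (w 1) := Int.gcd_pos_iff.2 (by
    by_contra! hc
    exact hw (funext fun i => by fin_cases i <;> simp [hc.1, hc.2]))
  obtain ⟨p, q, hpq, hp, hq⟩ := Int.exists_gcd_one hg
  have hw' : w = ((w 0).gcd (w 1) : ℤ) • ![p, q] := funext fun i => by
    fin_cases i
    · simpa [mul_comm] using hp
    · simpa [mul_comm] using hq
  refine ⟨![p, q], Int.isCoprime_iff_gcd_eq_one.2 hpq, ?_⟩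
  rw [hw', Matrix.smul_vecMul, smul_eq_zero] at hwA
  have := hwA.resolve_left (by exact_mod_cast hg.ne')
  rwa [Matrix.vecMul_sub, Matrix.vecMul_one, sub_eq_zero] at this

theorem lefschetzNumber_eq_zero {F : Plane ≃ₜ Plane} {f : Torus ≃ₜ Torus} (hF : IsLift F f)
    {A : Matrix (Fin 2) (Fin 2) ℤ} (hA : ∀ x n, F (x + intVec n) = F x + intVec (A.mulVec n))
    (hdet : (A - 1).det = 0) : lefschetzNumber f = 0 := by
  obtain ⟨w, ⟨a, b, hab⟩, hw⟩ := exists_coprime_vecMul_eq hdet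
  let P := integralHomeo a b (w 0) (w 1) hab
  -- The displacement of the coordinate `w · x`; it is periodic exactly because `w A = w`.
  let g : Plane → ℝ := fun x => w 0 * (F x 0 - x 0) + w 1 * (F x 1 - x 1)
  have hg : Continuous g := by fun_prop
  have hper : ∀ x n, g (x + intVec n) = g x := fun x n => by
    have h1 : w 0 * (A.mulVec n) 0 + w 1 * (A.mulVec n) 1 = w 0 * n 0 + w 1 * n 1 := by
      have := congrArg (fun u => u ⬝ᵥ n) hw
      rw [← Matrix.dotProduct_mulVec] at this
      simpa [Matrix.vec2_dotProduct, dotProduct, Fin.sum_univ_two] using this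
    have h2 := congrArg (Int.cast : ℤ → ℝ) h1
    push_cast at h2
    simp only [g, hA, Pi.add_apply, intVec]
    linear_combination h2
  have hgP : ∀ p, (P (f p)).2 = (P p).2 + (g (rep p) : UnitAddCircle) := fun p => by
    have h1 : f p = proj (F (rep p)) := by rw [hF, proj_rep]
    have h2 : P p = P (proj (rep p)) := by rw [proj_rep]
    rw [h1, h2]
    change w 0 • ((F (rep p) 0 : ℝ) : UnitAddCircle) + w 1 • ((F (rep p) 1 : ℝ) : UnitAddCircle) =
      w 0 • ((rep p 0 : ℝ) : UnitAddCircle) + w 1 • ((rep p 1 : ℝ) : UnitAddCircle) + _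
    simp only [g, ← AddCircle.coe_zsmul, ← AddCircle.coe_add]
    congr 1
    simp only [zsmul_eq_mul]
    ring
  have key := lefschetz_circle_prod
    ((P : C(Torus, _)).comp ((f : C(Torus, Torus)).comp (P.symm : C(_, Torus))))
    ((⟨g ∘ rep, continuous_comp_rep hg hper⟩ : C(Torus, ℝ)).comp (P.symm : C(_, Torus)))
    (fun x => by simpa using hgP (P.symm x))
  simp only [homologyTrace_conj] at key
  exact key

/-! ### The Markov–Kakutani fixed point theorem. -/

section FixedPoint

open Filter Topology

variable {ι : Type*}

/-- Orbit averages are almost fixed: `T (a n) - a n` telescopes to a bounded vector divided by `n +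
1`. Any cluster point is therefore fixed. -/
theorem exists_fixedPoint_of_linear {K : Set (ι → ℝ)} (hK : IsCompact K) (hne : K.Nonempty)
    (hc : Convex ℝ K) (T : (ι → ℝ) →L[ℝ] (ι → ℝ)) (hT : Set.MapsTo T K K) : ∃ x ∈ K, T x = x := by
  obtain ⟨x₀, hx₀⟩ := hne
  have hit : ∀ k : ℕ, (T^[k]) x₀ ∈ K := fun k => hT.iterate k hx₀
  let a : ℕ → ι → ℝ := fun n => ∑ k ∈ Finset.range (n + 1), ((n : ℝ) + 1)⁻¹ • (T^[k]) x₀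
  have ha : ∀ n, a n ∈ K := fun n => hc.sum_mem (fun _ _ => by positivity)
    (by simp; field_simp) (fun k _ => hit k)
  obtain ⟨y, hy, hcl⟩ := hK.exists_mapClusterPt (u := a) (f := atTop)
    (le_principal_iff.2 (mem_map.2 (Filter.univ_mem' ha)))
  refine ⟨y, hy, ?_⟩
  have hdiff : ∀ n, T (a n) - a n = ((n : ℝ) + 1)⁻¹ • ((T^[n + 1]) x₀ - x₀) := fun n => by
    simp only [a, map_sum, map_smul, ← Finset.smul_sum, ← smul_sub]
    congr 1
    rw [← Finset.sum_sub_distrib]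
    simp only [← Function.iterate_succ_apply' T]
    exact Finset.sum_range_sub (fun k => (T^[k]) x₀) (n + 1)
  have hlim : Tendsto (fun n => T (a n) - a n) atTop (𝓝 0) := by
    rw [tendsto_pi_nhds]
    intro i
    obtain ⟨C, hC⟩ := (hK.image (continuous_apply i)).isBounded.exists_norm_le
    refine squeeze_zero_norm (a := fun n : ℕ => ((n : ℝ) + 1)⁻¹ * (C + C)) (fun n => ?_) ?_
    · rw [hdiff, Pi.smul_apply, norm_smul, Real.norm_of_nonneg (by positivity)]
      gcongr
      exact (norm_sub_le _ _).trans (add_le_add (hC _ ⟨_, hit _, rfl⟩) (hC _ ⟨_, hx₀, rfl⟩))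
    · have := (tendsto_one_div_add_atTop_nhds_zero_nat (𝕜 := ℝ)).mul_const (C + C)
      simpa using this
  have hcl' : MapClusterPt (T y - y) atTop (fun n => T (a n) - a n) :=
    hcl.continuousAt_comp (f := fun z => T z - z) (by fun_prop)
  have : (𝓝 (T y - y) ⊓ 𝓝 0).NeBot := ClusterPt.mono hcl' hlim
  exact sub_eq_zero.1 (eq_of_nhds_neBot this)

/-- Each map preserves the fixed sets of the others, so finitely many have a common fixed point;
compactness gives all of them. Commutation is required only on `K`, since in the application the
maps commute only there. -/
theorem exists_common_fixedPoint {K : Set (ι → ℝ)} (hK : IsCompact K) (hne : K.Nonempty)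
    (hc : Convex ℝ K) {α : Type*} (T : α → (ι → ℝ) →L[ℝ] (ι → ℝ))
    (hT : ∀ i, Set.MapsTo (T i) K K) (hcomm : ∀ i j, ∀ x ∈ K, T i (T j x) = T j (T i x)) :
    ∃ x ∈ K, ∀ i, T i x = x := by
  have hclosed : ∀ i, IsClosed {x | T i x = x} := fun i => isClosed_eq (T i).continuous continuous_id
  have hfin : ∀ s : Finset α, (K ∩ ⋂ i ∈ s, {x | T i x = x}).Nonempty := by
    classical
    intro s
    induction s using Finset.induction_on with
    | empty => simpa using hne
    | insert j s _ ih =>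
      obtain ⟨x, ⟨hxK, hxs⟩, hx⟩ := exists_fixedPoint_of_linear
        (hK.inter_right (isClosed_biInter fun i _ => hclosed i)) ih
        (hc.inter (convex_iInter₂ fun i _ x hx y hy a b _ _ _ => by
          simp only [Set.mem_ofPred_eq] at hx hy ⊢
          rw [map_add, map_smul, map_smul, hx, hy])) (T j) (fun x ⟨hxK, hxs⟩ => by
          refine ⟨hT j hxK, ?_⟩
          simp only [Set.mem_iInter, Set.mem_ofPred_eq] at hxs ⊢
          intro i hi
          rw [hcomm i j x hxK, hxs i hi])
      refine ⟨x, hxK, ?_⟩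
      simp only [Finset.mem_insert, Set.mem_iInter, Set.mem_ofPred_eq, forall_eq_or_imp] at hxs ⊢
      exact ⟨hx, hxs⟩
  obtain ⟨x, hxK, hx⟩ := hK.inter_iInter_nonempty _ hclosed hfin
  exact ⟨x, hxK, fun i => Set.mem_iInter.1 hx i⟩

end FixedPoint

/-! ### Invariant probability measures of nilpotent groups. -/

section InvariantMeasure

variable (X : Type*) [TopologicalSpace X]

/-- The means on `C(X, ℝ)`: positive normalised linear functionals. -/
def means : Set (C(X, ℝ) → ℝ) :=
  {Λ | (∀ f g, Λ (f + g) = Λ f + Λ g) ∧ (∀ (c : ℝ) f, Λ (c • f) = c * Λ f) ∧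
    (∀ f, 0 ≤ f → 0 ≤ Λ f) ∧ Λ 1 = 1}

variable {X}

theorem means_mono {Λ : C(X, ℝ) → ℝ} (hΛ : Λ ∈ means X) {f g : C(X, ℝ)} (h : f ≤ g) : Λ f ≤ Λ g := by
  have h1 := hΛ.1 f (g - f)
  have h2 := hΛ.2.2.1 (g - f) (sub_nonneg.2 h)
  rw [add_sub_cancel] at h1
  linarith

theorem convex_means : Convex ℝ (means X) := by
  rintro Λ ⟨h1, h2, h3, h4⟩ Λ' ⟨h1', h2', h3', h4'⟩ a b ha hb hab
  refine ⟨fun f g => ?_, fun c f => ?_, fun f hf => ?_, ?_⟩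
  · simp [h1, h1']; ring
  · simp [h2, h2']; ring
  · have := h3 f hf
    have := h3' f hf
    simp only [Pi.add_apply, Pi.smul_apply, smul_eq_mul]
    positivity
  · simp [h4, h4', hab]

theorem isClosed_means : IsClosed (means X) := by
  have ev : ∀ f : C(X, ℝ), Continuous fun Λ : C(X, ℝ) → ℝ => Λ f := continuous_apply
  simp only [means, Set.ofPred_and, Set.ofPred_forall]
  refine (isClosed_iInter fun f => isClosed_iInter fun g => ?_).inter
    ((isClosed_iInter fun c => isClosed_iInter fun f => ?_).inter
      ((isClosed_iInter fun f => isClosed_iInter fun hf => ?_).inter ?_))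
  · exact isClosed_eq (ev _) ((ev f).add (ev g))
  · exact isClosed_eq (ev _) ((ev f).const_mul c)
  · exact isClosed_le continuous_const (ev f)
  · exact isClosed_eq (ev 1) continuous_const

/-- Positivity and normalisation give `|Λ f| ≤ ‖f‖`, so the means form a closed subset of a product
of compact intervals. -/
theorem isCompact_means [CompactSpace X] : IsCompact (means X) := by
  refine (isCompact_univ_pi fun f : C(X, ℝ) => isCompact_Icc (a := -‖f‖) (b := ‖f‖)).of_isClosed_subset
    isClosed_means fun Λ hΛ f _ => ?_
  have h : ∀ c : ℝ, Λ (c • 1) = c := fun c => by rw [hΛ.2.1, hΛ.2.2.2, mul_one]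
  constructor
  · rw [← h (-‖f‖)]
    exact means_mono hΛ fun x => by simpa using (abs_le.1 (f.norm_coe_le_norm x)).1
  · rw [← h ‖f‖]
    exact means_mono hΛ fun x => by simpa using (abs_le.1 (f.norm_coe_le_norm x)).2

theorem means_nonempty [Nonempty X] : (means X).Nonempty := by
  obtain ⟨x⟩ := ‹Nonempty X›
  exact ⟨fun f => f x, fun _ _ => rfl, fun _ _ => rfl, fun f hf => hf x, rfl⟩

/-- Push-forward of functionals by a homeomorphism. -/
def pushMean (g : X ≃ₜ X) : (C(X, ℝ) → ℝ) →L[ℝ] (C(X, ℝ) → ℝ) :=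
  ContinuousLinearMap.pi fun f => ContinuousLinearMap.proj (f.comp (g : C(X, X)))

theorem pushMean_mul (g h : X ≃ₜ X) (Λ : C(X, ℝ) → ℝ) :
    pushMean (g * h) Λ = pushMean g (pushMean h Λ) := rfl

theorem mapsTo_pushMean (g : X ≃ₜ X) : Set.MapsTo (pushMean g) (means X) (means X) :=
  fun _ ⟨h1, h2, h3, h4⟩ => ⟨fun f f' => h1 (f.comp (g : C(X, X))) (f'.comp (g : C(X, X))),
    fun c f => h2 c (f.comp (g : C(X, X))), fun _ hf => h3 _ fun x => hf (g x),
    h4⟩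

/-- Induction along the upper central series: on the means fixed by the `n`-th term, the next term
acts by commuting maps, because its commutators with `G` lie in the `n`-th term. -/
theorem exists_invariant_mean [CompactSpace X] [Nonempty X] (G : Subgroup (X ≃ₜ X))
    [Group.IsNilpotent G] : ∃ Λ ∈ means X, ∀ g ∈ G, pushMean g Λ = Λ := by
  have key : ∀ n, ∃ Λ ∈ means X, ∀ g ∈ Subgroup.upperCentralSeries G n, pushMean (g : X ≃ₜ X) Λ = Λ := by
    intro n
    induction n with
    | zero =>
      obtain ⟨Λ, hΛ⟩ := means_nonempty (X := X)
      refine ⟨Λ, hΛ, fun g hg => ?_⟩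
      rw [Subgroup.upperCentralSeries_zero, Subgroup.mem_bot] at hg
      subst hg
      rfl
    | succ n ih =>
      let S := ⋂ g ∈ Subgroup.upperCentralSeries G n, {Λ | pushMean (g : X ≃ₜ X) Λ = Λ}
      have hS : ∀ Λ, Λ ∈ S ↔ ∀ g ∈ Subgroup.upperCentralSeries G n, pushMean (g : X ≃ₜ X) Λ = Λ := by
        simp [S]
      have hcl : IsClosed S := isClosed_biInter fun g _ =>
        isClosed_eq (pushMean (g : X ≃ₜ X)).continuous continuous_id
      have hcv : Convex ℝ S := convex_iInter₂ fun g _ x hx y hy a b _ _ _ => by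
        simp only [Set.mem_ofPred_eq] at hx hy ⊢
        rw [map_add, map_smul, map_smul, hx, hy]
      obtain ⟨Λ, ⟨hΛ, -⟩, hinv⟩ := exists_common_fixedPoint (K := means X ∩ S)
        (isCompact_means.inter_right hcl) (by
          obtain ⟨Λ, h1, h2⟩ := ih
          exact ⟨Λ, h1, (hS Λ).2 h2⟩) (convex_means.inter hcv)
        (fun g : Subgroup.upperCentralSeries G (n + 1) => pushMean ((g : G) : X ≃ₜ X))
        (fun g Λ ⟨h1, h2⟩ => ⟨mapsTo_pushMean _ h1, (hS _).2 fun h hh => by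
          have hn : (g : G)⁻¹ * h * g ∈ Subgroup.upperCentralSeries G n := by
            simpa using
              (inferInstance : (Subgroup.upperCentralSeries G n).Normal).conj_mem h hh (g : G)⁻¹
          have := (hS _).1 h2 _ hn
          rw [← pushMean_mul]
          conv_rhs => rw [← this]
          rw [← pushMean_mul]
          congr 2
          push_cast
          group⟩)
        (fun g h Λ ⟨h1, h2⟩ => by
          -- Inverses are used because `g h = h g ⁅g⁻¹, h⁻¹⁆`, which puts the commutator next to
          -- `Λ`.
          have hn := Subgroup.mem_upperCentralSeries_succ_iff.1 (inv_mem g.2) (h : G)⁻¹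
          have := (hS _).1 h2 _ hn
          rw [← pushMean_mul, ← pushMean_mul]
          conv_rhs => rw [← this]
          rw [← pushMean_mul]
          congr 2
          rw [commutatorElement_def]
          push_cast
          group)
      exact ⟨Λ, hΛ, fun g hg => hinv ⟨g, hg⟩⟩
  obtain ⟨n, hn⟩ := Group.IsNilpotent.nilpotent (G := G)
  obtain ⟨Λ, hΛ, h⟩ := key n
  exact ⟨Λ, hΛ, fun g hg => h ⟨g, hg⟩ (hn ▸ Subgroup.mem_top _)⟩

/-- A nilpotent group of homeomorphisms of a compact space preserves a probability measure. -/
theorem exists_invariant_probabilityMeasure [CompactSpace X] [T2Space X] [MeasurableSpace X]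
    [BorelSpace X] [HasOuterApproxClosed X] [Nonempty X] (G : Subgroup (X ≃ₜ X))
    [Group.IsNilpotent G] :
    ∃ μ : ProbabilityMeasure X, ∀ g ∈ G, (μ : Measure X).map g = μ := by
  obtain ⟨Λ, hΛ, hinv⟩ := exists_invariant_mean G
  let L : CompactlySupportedContinuousMap X ℝ →ₚ[ℝ] ℝ :=
    { toFun := fun f => Λ f.toContinuousMap
      map_add' := fun f g => hΛ.1 f.toContinuousMap g.toContinuousMap
      map_smul' := fun c f => hΛ.2.1 c f.toContinuousMap
      monotone' := fun f g h => means_mono hΛ h }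
  let μ := RealRMK.rieszMeasure L
  have hμ : ∀ f : C(X, ℝ), ∫ x, f x ∂μ = Λ f := fun f =>
    RealRMK.integral_rieszMeasure L ⟨f, HasCompactSupport.of_compactSpace _⟩
  have hprob : IsProbabilityMeasure μ := by
    rw [isProbabilityMeasure_iff_real]
    have := hμ 1
    rw [hΛ.2.2.2] at this
    simpa using this
  refine ⟨⟨μ, hprob⟩, fun g hg => ?_⟩
  have hmeas : Measurable g := g.continuous.measurable
  have : IsFiniteMeasure (μ.map g) := inferInstance
  refine ext_of_forall_integral_eq_of_IsFiniteMeasure (μ := μ.map g) (ν := μ) fun f => ?_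
  rw [integral_map hmeas.aemeasurable f.continuous.aestronglyMeasurable]
  exact (hμ (f.toContinuousMap.comp (g : C(X, X)))).trans
    ((congrFun (hinv g hg) f.toContinuousMap).trans (hμ f.toContinuousMap).symm)

end InvariantMeasure

/-! ### Rotation vectors under composition, conjugation and commutators. -/

namespace CommutesWithTranslations

variable {F K : Plane ≃ₜ Plane}

theorem mul (hF : CommutesWithTranslations F) (hK : CommutesWithTranslations K) :
    CommutesWithTranslations (F * K) := fun x n => by
  change F (K (x + intVec n)) = F (K x) + intVec n
  rw [hK, hF]

theorem inv (hF : CommutesWithTranslations F) : CommutesWithTranslations F⁻¹ := fun x n => by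
  change F.symm (x + intVec n) = F.symm x + intVec n
  rw [Homeomorph.symm_apply_eq, hF, Homeomorph.apply_symm_apply]

theorem periodic (hF : CommutesWithTranslations F) (x : Plane) (n : Fin 2 → ℤ) :
    F (x + intVec n) - (x + intVec n) = F x - x := by
  rw [hF, add_sub_add_right_eq_sub]

theorem displacement_proj (hF : CommutesWithTranslations F) (x : Plane) :
    displacement F (proj x) = F x - x :=
  comp_rep_proj (g := fun x => F x - x) hF.periodic x

theorem continuous_displacement (hF : CommutesWithTranslations F) : Continuous (displacement F) :=
  continuous_comp_rep (g := fun x => F x - x) (F.continuous.sub continuous_id) hF.periodic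

theorem conj (hF : CommutesWithTranslations F) {Ψ : Plane ≃ₜ Plane} {ψ : Torus ≃ₜ Torus}
    (hΨ : IsLift Ψ ψ) : CommutesWithTranslations (Ψ * F * Ψ⁻¹) := fun x n => by
  obtain ⟨A, hA⟩ := hΨ.exists_matrix
  obtain ⟨B, hB⟩ := hΨ.inv.exists_matrix
  have hAB : intVec (A.mulVec (B.mulVec n)) = intVec n := by
    have h1 : Ψ (Ψ⁻¹ (x + intVec n)) = x + intVec n := Ψ.apply_symm_apply _
    have h2 : Ψ (Ψ⁻¹ x) = x := Ψ.apply_symm_apply _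
    rw [hB, hA, h2] at h1
    exact add_left_cancel h1
  change Ψ (F (Ψ⁻¹ (x + intVec n))) = Ψ (F (Ψ⁻¹ x)) + intVec n
  rw [hB, hF, hA, hAB]

end CommutesWithTranslations

section Rotation

variable {μ : ProbabilityMeasure Torus} {F K Ψ : Plane ≃ₜ Plane} {f k ψ : Torus ≃ₜ Torus}

theorem integrable_of_continuous {g : Torus → Plane} (hg : Continuous g) :
    Integrable g (μ : Measure Torus) :=
  hg.integrable_of_hasCompactSupport (HasCompactSupport.of_compactSpace _)

theorem integral_comp_of_map_eq (hk : (μ : Measure Torus).map k = μ) {g : Torus → Plane}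
    (hg : Continuous g) :
    ∫ p, g (k p) ∂(μ : Measure Torus) = ∫ p, g p ∂(μ : Measure Torus) := by
  conv_rhs => rw [← hk]
  rw [integral_map k.continuous.measurable.aemeasurable hg.aestronglyMeasurable]

/-- Displacement is a cocycle, and invariance of `μ` under `k` removes the composition with `k`. -/
theorem rotationVector_mul (hF : CommutesWithTranslations F) (hK : CommutesWithTranslations K)
    (hKk : IsLift K k) (hk : (μ : Measure Torus).map k = μ) :
    rotationVector μ (F * K) = rotationVector μ F + rotationVector μ K := by
  have h : ∀ p, displacement (F * K) p = displacement F (k p) + displacement K p := fun p => by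
    obtain ⟨x, rfl⟩ := isOpenQuotientMap_proj.surjective p
    rw [← hKk, hF.displacement_proj, hK.displacement_proj, (hF.mul hK).displacement_proj]
    exact (sub_add_sub_cancel _ _ _).symm
  have hc := hF.continuous_displacement
  simp only [rotationVector, h]
  rw [integral_add (f := fun p => displacement F (k p))
    (integrable_of_continuous (hc.comp k.continuous))
    (integrable_of_continuous hK.continuous_displacement), integral_comp_of_map_eq hk hc]

theorem rotationVector_of_translation {n : Fin 2 → ℤ} (hF : ∀ x, F x = x + intVec n) :
    rotationVector μ F = intVec n := by
  simp [rotationVector, displacement, hF]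

theorem rotationVector_inv (hF : CommutesWithTranslations F) (hFf : IsLift F f)
    (hf : (μ : Measure Torus).map f = μ) : rotationVector μ F⁻¹ = -rotationVector μ F := by
  have h1 := rotationVector_mul hF.inv hF hFf hf
  have h2 : rotationVector μ 1 = intVec 0 :=
    rotationVector_of_translation fun x => by ext i; simp [intVec]
  rw [inv_mul_cancel, h2] at h1
  rw [eq_neg_iff_add_eq_zero, ← h1]
  ext i; simp [intVec]

theorem intVec_mulVec (A : Matrix (Fin 2) (Fin 2) ℤ) (n : Fin 2 → ℤ) :
    intVec (A.mulVec n) = (A.map ((↑) : ℤ → ℝ)).mulVec (intVec n) := by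
  ext i
  simp [intVec, Matrix.mulVec, dotProduct]

/-- Write `Ψ = T + h` with `T` linear and `h` periodic. At `ψ p` the displacement of the conjugate
is `T` of that of `F` at `p` plus the coboundary `h ∘ f - h`, whose integral vanishes by invariance
under `f`. -/
theorem rotationVector_conj (hF : CommutesWithTranslations F) (hFf : IsLift F f)
    (hf : (μ : Measure Torus).map f = μ) (hΨ : IsLift Ψ ψ) (hψ : (μ : Measure Torus).map ψ = μ)
    {A : Matrix (Fin 2) (Fin 2) ℤ} (hA : ∀ x n, Ψ (x + intVec n) = Ψ x + intVec (A.mulVec n)) :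
    rotationVector μ (Ψ * F * Ψ⁻¹) = (A.map ((↑) : ℤ → ℝ)).mulVec (rotationVector μ F) := by
  let T : Plane →L[ℝ] Plane := (A.map ((↑) : ℤ → ℝ)).mulVecLin.toContinuousLinearMap
  have hT : ∀ v, T v = (A.map ((↑) : ℤ → ℝ)).mulVec v := fun v => rfl
  let h : Plane → Plane := fun x => Ψ x - T x
  have hper : ∀ x n, h (x + intVec n) = h x := fun x n => by
    simp only [h, hA, map_add, hT (intVec n), intVec_mulVec]
    abel
  have hc : Continuous (h ∘ rep) := continuous_comp_rep (Ψ.continuous.sub T.continuous) hper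
  have key : ∀ p, displacement (Ψ * F * Ψ⁻¹) (ψ p) =
      T (displacement F p) + ((h ∘ rep) (f p) - (h ∘ rep) p) := fun p => by
    obtain ⟨x, rfl⟩ := isOpenQuotientMap_proj.surjective p
    rw [← hFf, ← hΨ, hF.displacement_proj, (hF.conj hΨ).displacement_proj, Function.comp_apply,
      Function.comp_apply, comp_rep_proj hper, comp_rep_proj hper]
    have : (Ψ * F * Ψ⁻¹) (Ψ x) = Ψ (F x) := congrArg (fun y => Ψ (F y)) (Ψ.symm_apply_apply x)
    simp only [this, h, map_sub]
    abel
  have hd := hF.continuous_displacement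
  rw [rotationVector, ← integral_comp_of_map_eq hψ (hF.conj hΨ).continuous_displacement]
  simp only [key]
  rw [integral_add (f := fun p => T (displacement F p))
    (g := fun p => (h ∘ rep) (f p) - (h ∘ rep) p)
    (integrable_of_continuous (T.continuous.comp hd))
    ((integrable_of_continuous (hc.comp f.continuous)).sub (integrable_of_continuous hc)),
    integral_sub (f := fun p => (h ∘ rep) (f p))
      (integrable_of_continuous (hc.comp f.continuous)) (integrable_of_continuous hc),
    integral_comp_of_map_eq hf hc, sub_self, add_zero,
    T.integral_comp_comm (integrable_of_continuous hd), hT]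
  rfl

theorem rotationVector_commutator (hF : CommutesWithTranslations F) (hFf : IsLift F f)
    (hf : (μ : Measure Torus).map f = μ) (hΨ : IsLift Ψ ψ) (hψ : (μ : Measure Torus).map ψ = μ)
    {A : Matrix (Fin 2) (Fin 2) ℤ} (hA : ∀ x n, Ψ (x + intVec n) = Ψ x + intVec (A.mulVec n)) :
    rotationVector μ (Ψ * F * Ψ⁻¹ * F⁻¹) = ((A - 1).map ((↑) : ℤ → ℝ)).mulVec (rotationVector μ F) := by
  have hfi : (μ : Measure Torus).map (f⁻¹ : Torus ≃ₜ Torus) = μ := by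
    have h1 := congrArg (Measure.map (f⁻¹ : Torus ≃ₜ Torus)) hf
    rw [Measure.map_map (f⁻¹ : Torus ≃ₜ Torus).continuous.measurable f.continuous.measurable] at h1
    have : (⇑(f⁻¹ : Torus ≃ₜ Torus) ∘ ⇑f) = id := funext f.symm_apply_apply
    rw [this, Measure.map_id] at h1
    exact h1.symm
  rw [rotationVector_mul (hF.conj hΨ) hF.inv hFf.inv hfi,
    rotationVector_conj hF hFf hf hΨ hψ hA, rotationVector_inv hF hFf hf,
    Matrix.map_sub _ (fun a b => Int.cast_sub a b), Matrix.sub_mulVec,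
    Matrix.map_one _ Int.cast_zero Int.cast_one, Matrix.one_mulVec, sub_eq_add_neg]

variable {G : Subgroup (Torus ≃ₜ Torus)}

/-- Each commutator with `ψ` descends one step in the lower central series and multiplies the
rotation vector by `A - 1`. Once the series is trivial, the lift is an integer translation. That `n`
is chosen before `μ` is what yields independence of the measure. -/
theorem exists_pow_mulVec_rotationVector [Group.IsNilpotent G] (hψ : ψ ∈ G) (hΨ : IsLift Ψ ψ)
    {A : Matrix (Fin 2) (Fin 2) ℤ} (hA : ∀ x n, Ψ (x + intVec n) = Ψ x + intVec (A.mulVec n)) :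
    ∃ m : ℕ, ∀ f ∈ identityPart G, ∀ F, IsLift F f → ∃ n, ∀ μ ∈ invariantMeasures G,
      (((A - 1) ^ m).map ((↑) : ℤ → ℝ)).mulVec (rotationVector μ F) = intVec n := by
  have key : ∀ m : ℕ, ∀ f ∈ identityPart G, ∀ F, IsLift F f →
      ∃ f' : G, ∃ F', IsLift F' (f' : Torus ≃ₜ Torus) ∧ CommutesWithTranslations F' ∧
        f' ∈ (⊤ : Subgroup G).lowerCentralSeries m ∧ ∀ μ ∈ invariantMeasures G,
          rotationVector μ F' = (((A - 1) ^ m).map ((↑) : ℤ → ℝ)).mulVec (rotationVector μ F) := by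
    intro m f hf F hF
    induction m with
    | zero =>
      refine ⟨⟨f, hf.1⟩, F, hF, hF.commutesWithTranslations hf.2, Subgroup.mem_top _, fun μ _ => ?_⟩
      rw [pow_zero, Matrix.map_one _ Int.cast_zero Int.cast_one, Matrix.one_mulVec]
    | succ m ih =>
      obtain ⟨f', F', hF', hcF', hmem, hrot⟩ := ih
      refine ⟨⟨ψ, hψ⟩ * f' * ⟨ψ, hψ⟩⁻¹ * f'⁻¹, Ψ * F' * Ψ⁻¹ * F'⁻¹, ?_, ?_, ?_, fun μ hμ => ?_⟩
      · exact ((hΨ.mul hF').mul hΨ.inv).mul hF'.inv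
      · exact (hcF'.conj hΨ).mul hcF'.inv
      · rw [Subgroup.lowerCentralSeries_succ, Subgroup.commutator_comm]
        exact Subgroup.commutator_mem_commutator (Subgroup.mem_top _) hmem
      · rw [rotationVector_commutator hcF' hF' (hμ _ f'.2) hΨ (hμ _ hψ) hA, hrot μ hμ,
          Matrix.mulVec_mulVec, pow_succ', Matrix.map_mul_intCast]
  obtain ⟨m, hm⟩ := Subgroup.nilpotent_iff_lowerCentralSeries.1 ‹Group.IsNilpotent G›
  refine ⟨m, fun f hf F hF => ?_⟩
  obtain ⟨f', F', hF', -, hmem, hrot⟩ := key m f hf F hF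
  rw [hm, Subgroup.mem_bot] at hmem
  subst hmem
  obtain ⟨n, hn⟩ := isLift_one.exists_eq_add hF'
  exact ⟨n, fun μ hμ => (hrot μ hμ).symm.trans (rotationVector_of_translation hn)⟩

end Rotation

/-! ### Finiteness of the rotation image and the conclusion. -/

theorem zsmul_proj (d : ℤ) (x : Plane) : d • proj x = proj ((d : ℝ) • x) := by
  ext i
  change d • ((x i : ℝ) : UnitAddCircle) = (((d : ℝ) * x i : ℝ) : UnitAddCircle)
  rw [← AddCircle.coe_zsmul, zsmul_eq_mul]

theorem finite_torsion {d : ℤ} (hd : d ≠ 0) : {p : Torus | d • p = 0}.Finite := by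
  have h1 : {x : UnitAddCircle | d • x = 0}.Finite := by
    refine (AddCircle.finite_torsion (1 : ℝ) (Int.natAbs_pos.2 hd)).subset fun x hx => ?_
    obtain h | h := Int.natAbs_eq d
    · rw [Set.mem_ofPred_eq, h, natCast_zsmul] at hx
      exact hx
    · rw [Set.mem_ofPred_eq, h, neg_smul, natCast_zsmul, neg_eq_zero] at hx
      exact hx
  exact (Set.Finite.pi' fun _ : Fin 2 => h1).subset fun p hp i => congrFun hp i

theorem rotationVector_eq_add {μ : ProbabilityMeasure Torus} {F K : Plane ≃ₜ Plane}
    (hF : CommutesWithTranslations F) {n : Fin 2 → ℤ} (h : ∀ x, K x = F x + intVec n) :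
    rotationVector μ K = rotationVector μ F + intVec n := by
  have h1 : ∀ p, displacement K p = displacement F p + intVec n := fun p => by
    rw [displacement, displacement, h]; abel
  simp only [rotationVector, h1]
  rw [integral_add (integrable_of_continuous hF.continuous_displacement) (integrable_const _)]
  simp

theorem exists_lift_rotationVector_eq_zero {μ : ProbabilityMeasure Torus} {F : Plane ≃ₜ Plane}
    {f : Torus ≃ₜ Torus} (hF : CommutesWithTranslations F) (hFf : IsLift F f)
    (h : proj (rotationVector μ F) = 0) :
    ∃ K : Plane ≃ₜ Plane, IsLift K f ∧ rotationVector μ K = 0 := by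
  obtain ⟨n, hn⟩ := exists_eq_add_intVec h
  have hK : ∀ x, F.trans (Homeomorph.addRight (intVec n)) x = F x + intVec n := fun x => rfl
  exact ⟨_, fun x => by rw [hK, proj_add_intVec, hFf], (rotationVector_eq_add hF hK).trans hn.symm⟩

/-- The rotation homomorphism `G₀ → 𝕋²` of an invariant measure. -/
def rotationHom {G : Subgroup (Torus ≃ₜ Torus)} {μ : ProbabilityMeasure Torus}
    (hμ : μ ∈ invariantMeasures G) : identityPart G →* Multiplicative Torus :=
  MonoidHom.mk' (fun f => Multiplicative.ofAdd
    (proj (rotationVector μ (exists_isLift (f : Torus ≃ₜ Torus)).choose))) fun f k => by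
    have h : ∀ f : identityPart G, IsLift (exists_isLift (f : Torus ≃ₜ Torus)).choose f :=
      fun f => (exists_isLift (f : Torus ≃ₜ Torus)).choose_spec
    have hc := fun f : identityPart G => (h f).commutesWithTranslations f.2.2
    obtain ⟨n, hn⟩ := ((h f).mul (h k)).exists_eq_add (h (f * k))
    rw [← ofAdd_add, rotationVector_eq_add ((hc f).mul (hc k)) hn, proj_add_intVec,
      rotationVector_mul (hc f) (hc k) (h k) (hμ _ k.2.1), proj_add]

theorem rotationHom_eq {G : Subgroup (Torus ≃ₜ Torus)} {μ : ProbabilityMeasure Torus}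
    (hμ : μ ∈ invariantMeasures G) (f : identityPart G) {F : Plane ≃ₜ Plane} (hF : IsLift F f) :
    rotationHom hμ f = Multiplicative.ofAdd (proj (rotationVector μ F)) := by
  have h := (exists_isLift (f : Torus ≃ₜ Torus)).choose_spec
  obtain ⟨n, hn⟩ := h.exists_eq_add hF
  rw [rotationVector_eq_add (h.commutesWithTranslations f.2.2) hn, proj_add_intVec]
  rfl

theorem mem_ker_rotationHom {G : Subgroup (Torus ≃ₜ Torus)} {μ : ProbabilityMeasure Torus}
    (hμ : μ ∈ invariantMeasures G) (f : identityPart G) :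
    f ∈ (rotationHom hμ).ker ↔ (f : Torus ≃ₜ Torus) ∈ irrotationalAt G μ := by
  rw [MonoidHom.mem_ker]
  constructor
  · intro h
    obtain ⟨F, hF⟩ := exists_isLift (f : Torus ≃ₜ Torus)
    rw [rotationHom_eq hμ f hF] at h
    exact ⟨f.2, exists_lift_rotationVector_eq_zero (hF.commutesWithTranslations f.2.2) hF h⟩
  · rintro ⟨-, F, hF, h⟩
    rw [rotationHom_eq hμ f hF, h]
    rfl

/-- Multiplying by the adjugate shows that `det M` times the rotation vector is integral, so all
values lie in the finite `det M`-torsion of the torus. -/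
theorem finite_range_rotationHom {G : Subgroup (Torus ≃ₜ Torus)} {μ : ProbabilityMeasure Torus}
    (hμ : μ ∈ invariantMeasures G) {M : Matrix (Fin 2) (Fin 2) ℤ} (hM : M.det ≠ 0)
    (h : ∀ f ∈ identityPart G, ∀ F, IsLift F f → ∃ n,
      (M.map ((↑) : ℤ → ℝ)).mulVec (rotationVector μ F) = intVec n) :
    Finite (rotationHom hμ).range := by
  refine ((finite_torsion hM).preimage Multiplicative.toAdd.injective.injOn).subset ?_
  rintro _ ⟨f, rfl⟩
  obtain ⟨F, hF⟩ := exists_isLift (f : Torus ≃ₜ Torus)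
  obtain ⟨n, hn⟩ := h f f.2 F hF
  rw [Set.mem_preimage, Set.mem_ofPred_eq, rotationHom_eq hμ f hF, toAdd_ofAdd,
    zsmul_proj]
  have h1 := congrArg (M.adjugate.map ((↑) : ℤ → ℝ)).mulVec hn
  rw [Matrix.mulVec_mulVec, ← Matrix.map_mul_intCast, Matrix.adjugate_mul, ← intVec_mulVec] at h1
  have h2 : ((M.det • (1 : Matrix (Fin 2) (Fin 2) ℤ)).map ((↑) : ℤ → ℝ)) =
      (M.det : ℝ) • (1 : Matrix (Fin 2) (Fin 2) ℝ) := by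
    ext i j
    simp only [Matrix.map_apply, Matrix.smul_apply, Matrix.one_apply]
    split_ifs <;> simp
  rw [h2, Matrix.smul_mulVec, Matrix.one_mulVec] at h1
  rw [h1, proj_intVec]

theorem mulVec_intCast_injective {M : Matrix (Fin 2) (Fin 2) ℤ} (hM : M.det ≠ 0) :
    Function.Injective (M.map ((↑) : ℤ → ℝ)).mulVec := by
  rw [Matrix.mulVec_injective_iff_isUnit, Matrix.isUnit_iff_isUnit_det]
  have : (M.map ((↑) : ℤ → ℝ)).det = (M.det : ℝ) := ((Int.castRingHom ℝ).map_det M).symm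
  rw [this]
  exact isUnit_iff_ne_zero.2 (Int.cast_ne_zero.2 hM)

theorem irrotational_eq_and_finiteIndex (G : Subgroup (Torus ≃ₜ Torus))
    (hG : Group.IsNilpotent G)
    (hψ : ∃ ψ ∈ G, lefschetzNumber ψ ≠ 0) :
    (∀ μ ∈ invariantMeasures G,
      irrotationalLift G = irrotationalLiftAt G μ ∧
      irrotational G = irrotationalAt G μ) ∧
    ∃ N : Subgroup (identityPart G),
      (∀ f : identityPart G,
        f ∈ N ↔ (f : Torus ≃ₜ Torus) ∈ irrotational G) ∧
      N.Normal ∧ N.FiniteIndex := by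
  obtain ⟨ψ, hψG, hL⟩ := hψ
  obtain ⟨Ψ, hΨ⟩ := exists_isLift ψ
  obtain ⟨A, hA⟩ := hΨ.exists_matrix
  obtain ⟨m, hm⟩ := exists_pow_mulVec_rotationVector hψG hΨ hA
  have hdet : ((A - 1) ^ m).det ≠ 0 := by
    rw [Matrix.det_pow]
    exact pow_ne_zero _ fun h => hL (lefschetzNumber_eq_zero hΨ hA h)
  have hindep : ∀ f ∈ identityPart G, ∀ F, IsLift F f → ∀ μ ∈ invariantMeasures G,
      ∀ ν ∈ invariantMeasures G, rotationVector μ F = rotationVector ν F := by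
    intro f hf F hF μ hμ ν hν
    obtain ⟨n, hn⟩ := hm f hf F hF
    exact mulVec_intCast_injective hdet ((hn μ hμ).trans (hn ν hν).symm)
  have hirr : ∀ μ ∈ invariantMeasures G, irrotational G = irrotationalAt G μ := by
    intro μ hμ
    ext f
    constructor
    · rintro ⟨hf, -, F, hF, h⟩
      exact ⟨hf, F, hF, h μ hμ⟩
    · rintro ⟨hf, F, hF, h⟩
      exact ⟨hf, ⟨μ, hμ⟩, F, hF, fun ν hν => (hindep f hf F hF ν hν μ hμ).trans h⟩
  refine ⟨fun μ hμ => ⟨?_, hirr μ hμ⟩, ?_⟩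
  · ext F
    constructor
    · rintro ⟨h0, hF, h⟩
      exact ⟨h0, hF, h μ hμ⟩
    · rintro ⟨h0, ⟨f, hf, hF⟩, h⟩
      exact ⟨h0, ⟨f, hf, hF⟩, fun ν hν => (hindep f hf F hF ν hν μ hμ).trans h⟩
  -- The finite-index claim mentions no measure, so one has to be produced; `G_I` is then the kernel
  -- of its rotation homomorphism.
  · obtain ⟨μ, hμ⟩ : (invariantMeasures G).Nonempty := exists_invariant_probabilityMeasure G
    have := finite_range_rotationHom hμ hdet fun f hf F hF =>
      (hm f hf F hF).imp fun n hn => hn μ hμ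
    exact ⟨(rotationHom hμ).ker, fun f => by rw [mem_ker_rotationHom, hirr μ hμ], inferInstance,
      inferInstance⟩

end TorusAction

end

theorem mainTheorem6 (G : Subgroup (TorusAction.Torus ≃ₜ TorusAction.Torus))
    (hG : Group.IsNilpotent G)
    (hψ : ∃ ψ ∈ G, TorusAction.lefschetzNumber ψ ≠ 0) :
    (∀ μ ∈ TorusAction.invariantMeasures G,
      TorusAction.irrotationalLift G = TorusAction.irrotationalLiftAt G μ ∧
      TorusAction.irrotational G = TorusAction.irrotationalAt G μ) ∧
    ∃ N : Subgroup (TorusAction.identityPart G),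
      (∀ f : TorusAction.identityPart G,
        f ∈ N ↔ (f : TorusAction.Torus ≃ₜ TorusAction.Torus) ∈ TorusAction.irrotational G) ∧
      N.Normal ∧ N.FiniteIndex :=
  TorusAction.irrotational_eq_and_finiteIndex G hG hψ
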